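/- Throughout, $\log$ is the logarithm to base $2$, $\ln$ the natural logarithm, $a\vee b=\max\{a,b\}$, and $H(q)=-\sum_i q_i\log q_i$ (with $0\log 0=0$). **Setting.** Let $\mathbb X\subseteq\mathbb R$ and let $W$ be a channel with input alphabet $\mathbb X$ and output alphabet $\mathbb N_0$, i.e. $W(i|x)\ge 0$ and $\sum_{i\ge0}W(i|x)=1$ for all $x\in\mathbb X$. For an integer $M\ge1$ let $W_M(i|x)=W(i|x)+\frac1M\sum_{j\ge M}W(j|x)$, $0\le i\le M-1$, be its $M$-truncation. Let $\mathbb A=[a,b]\subseteq\mathbb X$ with $a<b$, and $\rho=b-a$. Assume that * every map $x\mapsto W(i|x)$ is Lipschitz on $\mathbb X$ with one constant $L$; * $\gamma_M:=\min_{0\le i<M}\min_{x\in\mathbb A}W_M(i|x)>0$; * the cost function $s:\mathbb X\to\mathbb R$ is Lipschitz with constant $L_s$, and $\min_{\mathbb A}s<S<\max_{\mathbb A}s$. Let $\mathcal D(\mathbb A)$ be the set of probability densities on $\mathbb A$; call $p\in\mathcal D(\mathbb A)$ feasible if $\int_{\mathbb A}p\,s\,dx=S$. For a density $p$ put $q^p_i=\int_{\mathbb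 A}W_M(i|x)p(x)\,dx$ and $I(p,W_M)=\int_{\mathbb A}\sum_{i}W_M(i|x)\log\frac{W_M(i|x)}{q^p_i}\,p(x)\,dx$. For $\lambda\in\mathbb R^M$ put $f_\lambda(x)=\sum_i W_M(i|x)\lambda_i-H(W_M(\cdot|x))$ (coordinates indexed by $i=0,\dots,M-1$), $$F(\lambda)=\max_{q\in\Delta_M}\{H(q)-\lambda^\top q\},\qquad G(\lambda)=\sup_{p\text{ feasible}}\int_{\mathbb A}p f_\lambda\,dx,$$ and for $\nu>0$ $$G_\nu(\lambda)=\sup_{p\text{ feasible}}\Big\{\int_{\mathbb A}pf_\lambda\,dx-\nu\int_{\mathbb A}p\log p\,dx-\nu\log\rho\Big\}.$$ Let $p_\nu^\lambda(x)=2^{\mu_1+\frac1\nu f_\lambda(x)+\mu_2s(x)}$ with $\mu_1,\mu_2\in\mathbb R$ chosen such that $p_\nu^\lambda$ is a feasible density. **Algorithm.** Let $Q=\{\lambda\in\mathbb R^M:\|\lambda\|_2\le M(\log\frac1{\gamma_M}\vee\frac1{\ln2})\}$, let $\pi_Q$ be the Euclidean projection onto $Q$, $L_\nu=1+\frac1\nu$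 and $g=\nabla F+\nabla G_\nu$. Choose any $x_0\in Q$ and for $k\ge0$ set $$y_k=\pi_Q\big(x_k-\tfrac1{L_\nu}g(x_k)\big),\quad z_k=\pi_Q\Big(-\tfrac1{L_\nu}\sum_{i=0}^k\tfrac{i+1}2g(x_i)\Big),\quad x_{k+1}=\tfrac2{k+3}z_k+\tfrac{k+1}{k+3}y_k .$$ After $n$ iterations let $\hat\lambda=y_n$ and $\hat p=\sum_{k=0}^n\frac{2(k+1)}{(n+1)(n+2)}p_\nu^{x_k}$. **Constants.** $D_1=\frac12\big(M\log\frac1{\gamma_M}\vee\frac1{\ln2}\big)^2$, $L_f=LM^2(\log\frac1{\gamma_M}\vee\frac1{\ln2})+ML\,|\log\frac1{\gamma_M}-\frac1{\ln2}|$, $\underline s=-S+\min_{\mathbb A}s$, $\overline s=-S+\max_{\mathbb A}s$, $$T_1=L_f\rho+2L_fL_s\rho^2\Big(\tfrac1{-\underline s}\vee\tfrac1{\overline s}\Big),\qquad T_2=L_s\rho\Big(\tfrac2{-\underline s}\log\big(\tfrac{2L_s\rho}{-\underline s}\vee1\big)\vee\tfrac2{\overline s}\log\big(\tfrac{2L_s\rho}{\overline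 s}\vee1\big)\Big),$$ and $\alpha=2(T_1+T_2+1)$. **Theorem.** For all $\nu>0$ and $\lambda\in\mathbb R^M$, numbers $\mu_1,\mu_2$ as required for $p^\lambda_\nu$ exist. Let $0<\varepsilon<\frac\alpha4$, $\nu=\dfrac{\varepsilon/\alpha}{\log(\alpha/\varepsilon)}$ and $$n\ \ge\ \tfrac1\varepsilon\sqrt{8D_1\alpha}\,\sqrt{\log(\varepsilon^{-1})+\log\alpha+\tfrac14}.$$ Then, for every starting point $x_0\in Q$, $\hat\lambda\in Q$, $\hat p$ is a feasible density, and $$0\le F(\hat\lambda)+G(\hat\lambda)-I(\hat p,W_M)\le\varepsilon .$$ Moreover $F(\hat\lambda)+G(\hat\lambda)\le F(\lambda)+G(\lambda)+\varepsilon$ for all $\lambda\in\mathbb R^M$ and $I(p,W_M)\le I(\hat p,W_M)+\varepsilon$ for all feasible densities $p$; we then call $(\hat\lambda,\hat p)$ an $\varepsilon$-solution. Consequently there are numbers $N(\varepsilon)\in\mathbb N_0$ with $N(\varepsilon)=O\big(\frac1\varepsilon\sqrt{\log(\varepsilon^{-1})}\big)$ as $\varepsilon\downarrow0$ such that for every $\varepsilon\in(0,\frac\alpha4)$,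 with $\nu$ as above, $N(\varepsilon)$ iterations from any $x_0\in Q$ give an $\varepsilon$-solution. -/

import Mathlib

open MeasureTheory Asymptotics
open scoped NNReal Topology Gradient

namespace ChannelCapacity

noncomputable section

/-- `W i x = W(i|x)` is a channel with input alphabet `X ⊆ ℝ` and output alphabet `ℕ`. -/
def IsChannel (X : Set ℝ) (W : ℕ → ℝ → ℝ) : Prop :=
  (∀ x ∈ X, ∀ i, 0 ≤ W i x) ∧ ∀ x ∈ X, HasSum (fun i => W i x) 1

/-- The `M`-truncated channel: the mass of the outputs `j ≥ M` is spread uniformly over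
`{0, …, M - 1}`. -/
def truncate (W : ℕ → ℝ → ℝ) (M : ℕ) : Fin M → ℝ → ℝ :=
  fun i x => W i x + (1 / (M : ℝ)) * ∑' j : ℕ, W (j + M) x

variable {M : ℕ}

/-- The smallest transition probability over the inputs in `A`. -/
def minProb (V : Fin M → ℝ → ℝ) (A : Set ℝ) : ℝ :=
  sInf {t | ∃ i : Fin M, ∃ x ∈ A, t = V i x}

/-- Shannon entropy in bits. -/
def entropy (q : Fin M → ℝ) : ℝ := ∑ i, -(q i * Real.logb 2 (q i))

/-- Relative entropy in bits. -/
def relEntropy (p q : Fin M → ℝ) : ℝ := ∑ i, p i * Real.logb 2 (p i / q i)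

/-- Probability densities on `A` (with respect to Lebesgue measure). -/
def IsDensity (A : Set ℝ) (p : ℝ → ℝ) : Prop :=
  IntegrableOn p A ∧ (∀ᵐ x ∂(volume.restrict A), 0 ≤ p x) ∧ ∫ x in A, p x = 1

/-- Densities on `A` that meet the average-cost constraint `⟨p, s⟩ = S`. -/
def IsFeasible (A : Set ℝ) (s : ℝ → ℝ) (S : ℝ) (p : ℝ → ℝ) : Prop :=
  IsDensity A p ∧ ∫ x in A, p x * s x = S

/-- Differential entropy in bits. -/
def diffEntropy (A : Set ℝ) (p : ℝ → ℝ) : ℝ := -∫ x in A, p x * Real.logb 2 (p x)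

/-- The output distribution induced by the input density `p`. -/
def outputDist (V : Fin M → ℝ → ℝ) (A : Set ℝ) (p : ℝ → ℝ) : Fin M → ℝ :=
  fun i => ∫ x in A, V i x * p x

/-- Mutual information `I(p, V) = ∫_A D(V(·|x) ‖ pV) p(x) dx`. -/
def mutualInfo (V : Fin M → ℝ → ℝ) (A : Set ℝ) (p : ℝ → ℝ) : ℝ :=
  ∫ x in A, relEntropy (fun i => V i x) (outputDist V A p) * p x

/-- `f_l(x) = ∑ i, V(i|x) l i - r(x)`, where `r(x)` is the entropy of `V(·|x)`. -/
def payoff (V : Fin M → ℝ → ℝ) (l : EuclideanSpace ℝ (Fin M)) (x : ℝ) : ℝ :=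
  ∑ i, V i x * l i - entropy (fun i => V i x)

/-- `F(l) = max {H(q) - ⟨l, q⟩ : q in the simplex}`. -/
def dualF (l : EuclideanSpace ℝ (Fin M)) : ℝ :=
  sSup {t | ∃ q ∈ stdSimplex ℝ (Fin M), t = entropy q - ∑ i, l i * q i}

/-- `G(l) = sup {⟨p, f_l⟩ : p a density on A, ⟨p, s⟩ = S}`. -/
def dualG (V : Fin M → ℝ → ℝ) (A : Set ℝ) (s : ℝ → ℝ) (S : ℝ)
    (l : EuclideanSpace ℝ (Fin M)) : ℝ :=
  sSup {t | ∃ p, IsFeasible A s S p ∧ t = ∫ x in A, p x * payoff V l x}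

/-- The smoothed function `G_ν`. Densities whose differential entropy is `-∞`, which do not
contribute to the supremum, are left out. -/
def smoothG (V : Fin M → ℝ → ℝ) (A : Set ℝ) (s : ℝ → ℝ) (S ν : ℝ)
    (l : EuclideanSpace ℝ (Fin M)) : ℝ :=
  sSup {t | ∃ p, IsFeasible A s S p ∧ IntegrableOn (fun x => p x * Real.logb 2 (p x)) A ∧
    t = (∫ x in A, p x * payoff V l x) + ν * diffEntropy A p
      - ν * Real.logb 2 (volume.real A)}

/-- `2 ^ (μ₁ + f_l(x) / ν + μ₂ s(x))`. -/
def gibbs (V : Fin M → ℝ → ℝ) (s : ℝ → ℝ) (ν : ℝ) (l : EuclideanSpace ℝ (Fin M))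
    (μ : ℝ × ℝ) (x : ℝ) : ℝ :=
  (2 : ℝ) ^ (μ.1 + (1 / ν) * payoff V l x + μ.2 * s x)

open Classical in
/-- The analytical optimizer `p_ν^l` of `G_ν(l)`: the function `gibbs` with `μ₁, μ₂` chosen so
that it is a density that meets the cost constraint. -/
def optDensity (V : Fin M → ℝ → ℝ) (A : Set ℝ) (s : ℝ → ℝ) (S ν : ℝ)
    (l : EuclideanSpace ℝ (Fin M)) : ℝ → ℝ :=
  if h : ∃ μ : ℝ × ℝ, IsFeasible A s S (gibbs V s ν l μ) then gibbs V s ν l h.choose else 0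

/-- Projection onto the Euclidean ball of radius `R` around the origin. -/
def ballProj (R : ℝ) (x : EuclideanSpace ℝ (Fin M)) : EuclideanSpace ℝ (Fin M) :=
  if R < ‖x‖ then (R / ‖x‖) • x else x

/-- Step 2 of the fast gradient method, for the gradient field `g`. -/
def stepY (R L : ℝ) (g : EuclideanSpace ℝ (Fin M) → EuclideanSpace ℝ (Fin M))
    (x : EuclideanSpace ℝ (Fin M)) : EuclideanSpace ℝ (Fin M) :=
  ballProj R (-(1 / L) • g x + x)

/-- Fast gradient method on the ball of radius `R`: the pair of the iterate `x k` and the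
weighted sum `∑ i < k, ((i + 1) / 2) • g (x i)` of the previous gradients. -/
def fastGradient (R L : ℝ) (g : EuclideanSpace ℝ (Fin M) → EuclideanSpace ℝ (Fin M))
    (x₀ : EuclideanSpace ℝ (Fin M)) :
    ℕ → EuclideanSpace ℝ (Fin M) × EuclideanSpace ℝ (Fin M)
  | 0 => (x₀, 0)
  | k + 1 =>
    let x := (fastGradient R L g x₀ k).1
    let w := (fastGradient R L g x₀ k).2 + (((k : ℝ) + 1) / 2) • g x
    let y := stepY R L g x
    let z := ballProj R (-(1 / L) • w)
    ((2 / ((k : ℝ) + 3)) • z + (((k : ℝ) + 1) / ((k : ℝ) + 3)) • y, w)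

/-- The radius of the dual feasible set `Q`. -/
def dualRadius (V : Fin M → ℝ → ℝ) (A : Set ℝ) : ℝ :=
  M * max (Real.logb 2 (minProb V A)⁻¹) (1 / Real.log 2)

/-- The dual feasible set `Q`. -/
def dualSet (V : Fin M → ℝ → ℝ) (A : Set ℝ) : Set (EuclideanSpace ℝ (Fin M)) :=
  {l | ‖l‖ ≤ dualRadius V A}

/-- The iterate `x_k` of the fast gradient method for the minimization of `F + G_ν` over `Q`,
with step parameter `1 + 1 / ν`. -/
def iterX (V : Fin M → ℝ → ℝ) (A : Set ℝ) (s : ℝ → ℝ) (S ν : ℝ)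
    (x₀ : EuclideanSpace ℝ (Fin M)) (k : ℕ) : EuclideanSpace ℝ (Fin M) :=
  (fastGradient (dualRadius V A) (1 + 1 / ν)
    (fun l => ∇ dualF l + ∇ (smoothG V A s S ν) l) x₀ k).1

/-- The dual approximate solution `y_n`. -/
def dualApprox (V : Fin M → ℝ → ℝ) (A : Set ℝ) (s : ℝ → ℝ) (S ν : ℝ)
    (x₀ : EuclideanSpace ℝ (Fin M)) (n : ℕ) : EuclideanSpace ℝ (Fin M) :=
  stepY (dualRadius V A) (1 + 1 / ν)
    (fun l => ∇ dualF l + ∇ (smoothG V A s S ν) l) (iterX V A s S ν x₀ n)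

/-- The primal approximate solution, a weighted average of the `p_ν^{x_k}`. -/
def primalApprox (V : Fin M → ℝ → ℝ) (A : Set ℝ) (s : ℝ → ℝ) (S ν : ℝ)
    (x₀ : EuclideanSpace ℝ (Fin M)) (n : ℕ) (x : ℝ) : ℝ :=
  ∑ k ∈ Finset.range (n + 1),
    2 * ((k : ℝ) + 1) / (((n : ℝ) + 1) * ((n : ℝ) + 2)) *
      optDensity V A s S ν (iterX V A s S ν x₀ k) x

/-- `(l, p)` is an `ε`-solution of the dual and primal problems: both are feasible, the
primal-dual gap lies in `[0, ε]`, and each is optimal for its problem up to `ε`. -/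
def IsEpsSolution (V : Fin M → ℝ → ℝ) (A : Set ℝ) (s : ℝ → ℝ) (S ε : ℝ)
    (l : EuclideanSpace ℝ (Fin M)) (p : ℝ → ℝ) : Prop :=
  l ∈ dualSet V A ∧ IsFeasible A s S p ∧
  0 ≤ dualF l + dualG V A s S l - mutualInfo V A p ∧
  dualF l + dualG V A s S l - mutualInfo V A p ≤ ε ∧
  (∀ l', dualF l + dualG V A s S l ≤ dualF l' + dualG V A s S l' + ε) ∧
  ∀ p', IsFeasible A s S p' → mutualInfo V A p' ≤ mutualInfo V A p + ε

/-- `D₁`. -/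
def constD₁ (V : Fin M → ℝ → ℝ) (A : Set ℝ) : ℝ :=
  (1 / 2) * (max (M * Real.logb 2 (minProb V A)⁻¹) (1 / Real.log 2)) ^ 2

/-- The constant `L_f`, for channel maps with Lipschitz constant `L`. -/
def constLf (V : Fin M → ℝ → ℝ) (A : Set ℝ) (L : ℝ) : ℝ :=
  L * (M : ℝ) ^ 2 * max (Real.logb 2 (minProb V A)⁻¹) (1 / Real.log 2)
    + M * L * |Real.logb 2 (minProb V A)⁻¹ - 1 / Real.log 2|

/-- `-S + min_A s`. -/
def sLow (A : Set ℝ) (s : ℝ → ℝ) (S : ℝ) : ℝ := -S + sInf (s '' A)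

/-- `-S + max_A s`. -/
def sHigh (A : Set ℝ) (s : ℝ → ℝ) (S : ℝ) : ℝ := -S + sSup (s '' A)

/-- `T₁`. -/
def constT₁ (V : Fin M → ℝ → ℝ) (A : Set ℝ) (s : ℝ → ℝ) (S L Ls : ℝ) : ℝ :=
  constLf V A L * volume.real A
    + 2 * constLf V A L * Ls * (volume.real A) ^ 2 * max (1 / -sLow A s S) (1 / sHigh A s S)

/-- `T₂`. -/
def constT₂ (A : Set ℝ) (s : ℝ → ℝ) (S Ls : ℝ) : ℝ :=
  Ls * volume.real A * max
    (2 / -sLow A s S * Real.logb 2 (max (2 * Ls * volume.real A / -sLow A s S) 1))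
    (2 / sHigh A s S * Real.logb 2 (max (2 * Ls * volume.real A / sHigh A s S) 1))

/-- `α = 2 (T₁ + T₂ + 1)`. -/
def constα (V : Fin M → ℝ → ℝ) (A : Set ℝ) (s : ℝ → ℝ) (S L Ls : ℝ) : ℝ :=
  2 * (constT₁ V A s S L Ls + constT₂ A s S Ls + 1)

/-- The smoothing parameter `ν = (ε / α) / log (α / ε)`. -/
def smoothing (α ε : ℝ) : ℝ := (ε / α) / Real.logb 2 (α / ε)

/-- The number of iterations prescribed for the accuracy `ε`. -/
def iterBound (D₁ α ε : ℝ) : ℝ :=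
  (1 / ε) * √(8 * D₁ * α) * √(Real.logb 2 ε⁻¹ + Real.logb 2 α + 1 / 4)

end

end ChannelCapacity

open ChannelCapacity

/-!
For `l` in the dual ball, weak duality gives `I(p) ≤ F(l) + G(l)`, so it suffices to bound the gap
at the output of the fast gradient method by `ε`. Both `F` and `G_ν` are suprema of affine functions
of `l` penalised by a negative entropy. The inequalities of Gibbs and Hoeffding make the maximizers
stable, so that `F + G_ν` is differentiable with a `(1 + 1 / ν)`-Lipschitz gradient, and Nesterov's
method bounds `F + G_ν` at `y_n` by the weighted average of its linearizations at the points `x_k`,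
evaluated at any point `u` of the ball, plus an error of order `1 / (ν n ^ 2)`. At `u = -log q`,
where `q` is the output distribution of the averaged primal density, the linearizations of `F` are
nonpositive and those of `G_ν` average to at most the mutual information of that density.

The smoothing costs at most `ν` times the logarithm of the maximal value of the Gibbs density
relative to the uniform one. The payoff is Lipschitz and its Lagrange multiplier is controlled by
the slack in the cost constraint, so this maximal value is `O(1 / ν)`. The choice
`ν ~ ε / log (1 / ε)` balances the two errors.
-/

namespace ChannelCapacity

/-- `p` is a probability density with respect to the measure `m`. With counting measure on a
finite type these are the points of the simplex. -/
structure IsProbDensity {Ω : Type*} [MeasurableSpace Ω] (m : Measure Ω) (p : Ω → ℝ) : Prop where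
  integrable : Integrable p m
  nonneg : ∀ᵐ x ∂m, 0 ≤ p x
  integral_eq_one : ∫ x, p x ∂m = 1

section EntropyInequalities

variable {Ω : Type*} [MeasurableSpace Ω] {m : Measure Ω} {p p₀ r h : Ω → ℝ} {b B : ℝ}

theorem IsProbDensity.ne_zero (hp : IsProbDensity m p) : m ≠ 0 := by
  rintro rfl
  simpa using hp.integral_eq_one

theorem integral_pos_of_ae_pos (hm : m ≠ 0) (hr : Integrable r m) (hr0 : ∀ᵐ x ∂m, 0 < r x) :
    0 < ∫ x, r x ∂m := by
  have hnonneg : 0 ≤ᵐ[m] r := hr0.mono fun x hx => hx.le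
  refine (integral_nonneg_of_ae hnonneg).lt_of_ne' fun h0 => hm ?_
  have hzero : r =ᵐ[m] 0 := (integral_eq_zero_iff_of_nonneg_ae hnonneg hr).1 h0
  refine ae_eq_bot.1 (Filter.eventually_false_iff_eq_bot.1 ?_)
  filter_upwards [hr0, hzero] with x hpos hx using hpos.ne' hx

theorem mul_logb_sub_mul_logb_le (hb : 1 < b) {s t : ℝ} (hs : 0 ≤ s) (ht : 0 < t) :
    s * Real.logb b t - s * Real.logb b s ≤ (t - s) / Real.log b := by
  have hlogb : 0 < Real.log b := Real.log_pos hb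
  rcases hs.eq_or_lt with rfl | hs
  · simpa using (div_pos ht hlogb).le
  · have key : Real.log (t / s) ≤ t / s - 1 := Real.log_le_sub_one_of_pos (by positivity)
    rw [Real.log_div ht.ne' hs.ne'] at key
    calc s * Real.logb b t - s * Real.logb b s
        = s * (Real.log t - Real.log s) / Real.log b := by simp only [Real.logb]; ring
      _ ≤ s * (t / s - 1) / Real.log b := by gcongr
      _ = (t - s) / Real.log b := by field_simp

theorem IsProbDensity.integral_mul_logb_le (hp : IsProbDensity m p) (hb : 1 < b)
    (hr : Integrable r m) (hr0 : ∀ᵐ x ∂m, 0 < r x)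
    (hpp : Integrable (fun x => p x * Real.logb b (p x)) m)
    (hpr : Integrable (fun x => p x * Real.logb b (r x)) m) :
    ∫ x, p x * Real.logb b (r x) ∂m
      ≤ Real.logb b (∫ x, r x ∂m) + ∫ x, p x * Real.logb b (p x) ∂m := by
  set Z : ℝ := ∫ x, r x ∂m with hZ
  have hZ0 : 0 < Z := integral_pos_of_ae_pos hp.ne_zero hr hr0
  have hpoint : ∀ᵐ x ∂m, p x * Real.logb b (r x) - p x * Real.logb b (p x)
      - p x * Real.logb b Z ≤ (r x / Z - p x) / Real.log b := by
    filter_upwards [hp.nonneg, hr0] with x hpx hrx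
    have := mul_logb_sub_mul_logb_le hb hpx (div_pos hrx hZ0)
    rw [Real.logb_div hrx.ne' hZ0.ne'] at this
    linarith
  have hdiff : Integrable (fun x => p x * Real.logb b (r x) - p x * Real.logb b (p x)) m :=
    hpr.sub hpp
  have hmono := integral_mono_ae (hdiff.sub (hp.integrable.mul_const _))
    (((hr.div_const Z).sub hp.integrable).div_const _) hpoint
  simp only [Pi.sub_apply] at hmono
  rw [integral_sub hdiff (hp.integrable.mul_const _), integral_sub hpr hpp, integral_mul_const,
    integral_div, integral_sub (hr.div_const Z) hp.integrable, integral_div, ← hZ,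
    div_self hZ0.ne', hp.integral_eq_one, sub_self, zero_div] at hmono
  linarith

theorem integral_exp_le_of_abs_le [IsProbabilityMeasure m] (hh : AEMeasurable h m)
    (hhB : ∀ᵐ x ∂m, |h x| ≤ B) :
    ∫ x, Real.exp (h x) ∂m ≤ Real.exp ((∫ x, h x ∂m) + B ^ 2 / 2) := by
  have hmem : ∀ᵐ x ∂m, h x ∈ Set.Icc (-B) B := hhB.mono fun x hx => abs_le.mp hx
  have hmgf := (ProbabilityTheory.hasSubgaussianMGF_of_mem_Icc hh hmem).mgf_le 1
  have hvar : (((‖B - -B‖₊ / 2) ^ 2 : ℝ≥0) : ℝ) = B ^ 2 := by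
    push_cast
    rw [sub_neg_eq_add, ← two_mul, norm_mul, Real.norm_two, mul_div_cancel_left₀ _ two_ne_zero,
      Real.norm_eq_abs, sq_abs]
  simp only [hvar, ProbabilityTheory.mgf, one_mul, Real.exp_sub, integral_div, one_pow,
    mul_one] at hmgf
  rw [div_le_iff₀ (Real.exp_pos _)] at hmgf
  rwa [add_comm, Real.exp_add]

theorem IsProbDensity.isProbabilityMeasure (hp : IsProbDensity m p) :
    IsProbabilityMeasure (m.withDensity fun x => ENNReal.ofReal (p x)) where
  measure_univ := by
    rw [withDensity_apply _ MeasurableSet.univ, Measure.restrict_univ,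
      ← ofReal_integral_eq_lintegral_ofReal hp.integrable hp.nonneg, hp.integral_eq_one,
      ENNReal.ofReal_one]

theorem IsProbDensity.integral_withDensity (hp : IsProbDensity m p) (h : Ω → ℝ) :
    ∫ x, h x ∂(m.withDensity fun x => ENNReal.ofReal (p x)) = ∫ x, p x * h x ∂m := by
  rw [integral_withDensity_eq_integral_toReal_smul₀
    hp.integrable.aestronglyMeasurable.aemeasurable.ennreal_ofReal
    (Filter.Eventually.of_forall fun x => ENNReal.ofReal_lt_top)]
  refine integral_congr_ae ?_
  filter_upwards [hp.nonneg] with x hx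
  rw [ENNReal.toReal_ofReal hx, smul_eq_mul]

theorem IsProbDensity.integral_mul_exp_le (hp : IsProbDensity m p) (hh : AEMeasurable h m)
    (hhB : ∀ᵐ x ∂m, |h x| ≤ B) :
    ∫ x, p x * Real.exp (h x) ∂m ≤ Real.exp ((∫ x, p x * h x ∂m) + B ^ 2 / 2) := by
  have hac := withDensity_absolutelyContinuous m fun x => ENNReal.ofReal (p x)
  have := hp.isProbabilityMeasure
  have hoeffding := integral_exp_le_of_abs_le (hh.mono_ac hac) (hac.ae_le hhB)
  rwa [hp.integral_withDensity, hp.integral_withDensity] at hoeffding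

theorem integrable_mul_two_rpow (hp : Integrable p m)
    (hh : AEStronglyMeasurable h m) (hhB : ∀ᵐ x ∂m, |h x| ≤ B) :
    Integrable (fun x => p x * (2 : ℝ) ^ h x) m := by
  refine hp.mul_bdd (c := (2 : ℝ) ^ B)
    ((Real.continuous_const_rpow two_ne_zero).comp_aestronglyMeasurable hh) ?_
  filter_upwards [hhB] with x hx
  rw [Real.norm_of_nonneg (by positivity)]
  exact Real.rpow_le_rpow_of_exponent_le one_le_two (abs_le.mp hx).2

theorem IsProbDensity.logb_integral_mul_two_rpow_le (hp : IsProbDensity m p)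
    (hp0 : ∀ᵐ x ∂m, 0 < p x) (hh : AEStronglyMeasurable h m) (hhB : ∀ᵐ x ∂m, |h x| ≤ B) :
    Real.logb 2 (∫ x, p x * (2 : ℝ) ^ h x ∂m) ≤ (∫ x, p x * h x ∂m) + B ^ 2 / 2 := by
  have hlog2 : 0 < Real.log 2 := Real.log_pos one_lt_two
  have hscaled : ∀ᵐ x ∂m, |Real.log 2 * h x| ≤ Real.log 2 * B := by
    filter_upwards [hhB] with x hx
    rw [abs_mul, abs_of_pos hlog2]
    gcongr
  have hoeffding := hp.integral_mul_exp_le (hh.aemeasurable.const_mul _) hscaled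
  simp only [← Real.rpow_def_of_pos two_pos, mul_left_comm _ (Real.log 2),
    integral_const_mul] at hoeffding
  rw [← Real.log_le_iff_le_exp (integral_pos_of_ae_pos hp.ne_zero
    (integrable_mul_two_rpow hp.integrable hh hhB) (hp0.mono fun x hx => by positivity))]
    at hoeffding
  rw [Real.logb, div_le_iff₀ hlog2]
  nlinarith [mul_nonneg hlog2.le (sq_nonneg B), Real.log_two_lt_d9]

/-- Gibbs' inequality against `p₀ 2 ^ h`, whose mass Hoeffding's lemma bounds. -/
theorem IsProbDensity.integral_mul_le_add (hp : IsProbDensity m p) (hp₀ : IsProbDensity m p₀)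
    (hp₀0 : ∀ᵐ x ∂m, 0 < p₀ x) (hpp : Integrable (fun x => p x * Real.logb 2 (p x)) m)
    (hpp₀ : Integrable (fun x => p x * Real.logb 2 (p₀ x)) m)
    (hh : AEStronglyMeasurable h m) (hhB : ∀ᵐ x ∂m, |h x| ≤ B) :
    ∫ x, p x * h x ∂m ≤ (∫ x, p₀ x * h x ∂m)
      + ((∫ x, p x * Real.logb 2 (p x) ∂m) - ∫ x, p x * Real.logb 2 (p₀ x) ∂m) + B ^ 2 / 2 := by
  have hph : Integrable (fun x => p x * h x) m := hp.integrable.mul_bdd hh hhB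
  have hlog : (fun x => p x * Real.logb 2 (p₀ x * (2 : ℝ) ^ h x))
      =ᵐ[m] fun x => p x * Real.logb 2 (p₀ x) + p x * h x := by
    filter_upwards [hp₀0] with x hx
    rw [Real.logb_mul hx.ne' (by positivity), Real.logb_rpow two_pos (by norm_num), mul_add]
  have hgibbs := hp.integral_mul_logb_le one_lt_two
    (integrable_mul_two_rpow hp₀.integrable hh hhB) (hp₀0.mono fun x hx => by positivity) hpp
    ((integrable_congr hlog).mpr (hpp₀.add hph))
  rw [integral_congr_ae hlog, integral_add hpp₀ hph] at hgibbs
  linarith [hp₀.logb_integral_mul_two_rpow_le hp₀0 hh hhB]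

end EntropyInequalities

section ConvexSmooth

variable {E : Type*} [NormedAddCommGroup E] [InnerProductSpace ℝ E] {f f₁ f₂ : E → ℝ}
  {g g₁ g₂ : E → E} {C C₁ C₂ : ℝ}

/-- The first-order model at `x` of a function `f` with gradient field `g`. -/
def linearization (f : E → ℝ) (g : E → E) (x y : E) : ℝ := f x + inner ℝ (g x) (y - x)

/-- `f` is convex and `C`-smooth with gradient field `g`, expressed by the two quadratic bounds
that first-order methods use: `f` lies above its first-order models and exceeds them by at most
`C / 2 * ‖y - x‖ ^ 2`. -/
structure IsConvexSmooth (f : E → ℝ) (g : E → E) (C : ℝ) : Prop where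
  linearization_le : ∀ x y, linearization f g x y ≤ f y
  le_linearization_add : ∀ x y, f y ≤ linearization f g x y + C / 2 * ‖y - x‖ ^ 2

theorem linearization_add (x y : E) : linearization (fun z => f₁ z + f₂ z)
    (fun z => g₁ z + g₂ z) x y = linearization f₁ g₁ x y + linearization f₂ g₂ x y := by
  simp only [linearization, inner_add_left]
  ring

theorem IsConvexSmooth.add (h₁ : IsConvexSmooth f₁ g₁ C₁) (h₂ : IsConvexSmooth f₂ g₂ C₂) :
    IsConvexSmooth (fun z => f₁ z + f₂ z) (fun z => g₁ z + g₂ z) (C₁ + C₂) where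
  linearization_le x y := by
    rw [linearization_add]
    exact add_le_add (h₁.linearization_le x y) (h₂.linearization_le x y)
  le_linearization_add x y := by
    rw [linearization_add]
    linarith [h₁.le_linearization_add x y, h₂.le_linearization_add x y]

theorem IsConvexSmooth.hasGradientAt [CompleteSpace E] (h : IsConvexSmooth f g C) (x : E) :
    HasGradientAt f (g x) x := by
  rw [hasGradientAt_iff_isLittleO]
  have hquad : (fun y => f y - f x - inner ℝ (g x) (y - x)) =O[𝓝 x] fun y => ‖y - x‖ ^ 2 := by
    refine IsBigO.of_bound (C / 2) (Filter.Eventually.of_forall fun y => ?_)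
    have hlow := h.linearization_le x y
    have hup := h.le_linearization_add x y
    rw [linearization] at hlow hup
    rw [Real.norm_of_nonneg (by linarith), Real.norm_of_nonneg (by positivity)]
    linarith
  exact hquad.trans_isLittleO (isLittleO_pow_sub_sub x one_lt_two)

theorem IsConvexSmooth.gradient_eq [CompleteSpace E] (h : IsConvexSmooth f g C) (x : E) :
    ∇ f x = g x := (h.hasGradientAt x).gradient

theorem IsConvexSmooth.isConvexSmooth_gradient [CompleteSpace E] (h : IsConvexSmooth f g C) :
    IsConvexSmooth f (∇ f) C := by
  rwa [funext h.gradient_eq]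

theorem isConvexSmooth_sSup {ι : Type*} {P : ι → Prop} {val : E → ι → ℝ} {opt : E → ι}
    (hopt : ∀ x, P (opt x))
    (hle : ∀ x y p, P p → val y p ≤ val y (opt x) + C / 2 * ‖y - x‖ ^ 2)
    (haff : ∀ x y, val y (opt x) = val x (opt x) + inner ℝ (g x) (y - x)) :
    IsConvexSmooth (fun x => sSup {t | ∃ p, P p ∧ t = val x p}) g C := by
  have hsSup : ∀ x, sSup {t | ∃ p, P p ∧ t = val x p} = val x (opt x) := fun x => by
    refine IsGreatest.csSup_eq ⟨⟨opt x, hopt x, rfl⟩, ?_⟩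
    rintro _ ⟨p, hp, rfl⟩
    simpa using hle x x p hp
  constructor <;> intro x y <;> rw [linearization, hsSup, hsSup, ← haff]
  · simpa using hle y y (opt x) (hopt x)
  · exact hle x y _ (hopt y)

end ConvexSmooth

section FastGradient

variable {M : ℕ} {R L : ℝ}

theorem norm_ballProj_le (hR : 0 ≤ R) (x : EuclideanSpace ℝ (Fin M)) : ‖ballProj R x‖ ≤ R := by
  unfold ballProj
  split_ifs with h
  · have hx : 0 < ‖x‖ := hR.trans_lt h
    rw [norm_smul, Real.norm_of_nonneg (by positivity), div_mul_cancel₀ _ hx.ne']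
  · exact not_lt.mp h

theorem inner_sub_ballProj_nonpos (hR : 0 ≤ R) (w : EuclideanSpace ℝ (Fin M))
    {x : EuclideanSpace ℝ (Fin M)} (hx : ‖x‖ ≤ R) :
    inner ℝ (w - ballProj R w) (x - ballProj R w) ≤ 0 := by
  unfold ballProj
  split_ifs with h
  · have hw : 0 < ‖w‖ := hR.trans_lt h
    have hfactor : w - (R / ‖w‖) • w = (1 - R / ‖w‖) • w := by rw [sub_smul, one_smul]
    have hradial : inner ℝ w (x - (R / ‖w‖) • w) ≤ 0 := by
      have hcs := real_inner_le_norm w x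
      rw [inner_sub_right, real_inner_smul_right, real_inner_self_eq_norm_sq,
        show R / ‖w‖ * ‖w‖ ^ 2 = ‖w‖ * R by field_simp]
      nlinarith
    rw [hfactor, real_inner_smul_left]
    exact mul_nonpos_of_nonneg_of_nonpos (sub_nonneg.mpr ((div_le_one hw).mpr h.le)) hradial
  · simp

theorem inner_add_sq_ballProj_le (hR : 0 ≤ R) (hL : 0 < L) (x d : EuclideanSpace ℝ (Fin M))
    {u : EuclideanSpace ℝ (Fin M)} (hu : ‖u‖ ≤ R) :
    inner ℝ d (ballProj R (-(1 / L) • d + x)) + L / 2 * ‖ballProj R (-(1 / L) • d + x) - x‖ ^ 2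
      + L / 2 * ‖u - ballProj R (-(1 / L) • d + x)‖ ^ 2
      ≤ inner ℝ d u + L / 2 * ‖u - x‖ ^ 2 := by
  have hproj := inner_sub_ballProj_nonpos hR (-(1 / L) • d + x) hu
  set y := ballProj R (-(1 / L) • d + x)
  have hexpand : ‖u - x‖ ^ 2 = ‖u - y‖ ^ 2 - 2 * inner ℝ (x - y) (u - y) + ‖y - x‖ ^ 2 := by
    rw [show u - x = (u - y) - (x - y) by abel, norm_sub_sq_real, norm_sub_rev y x,
      real_inner_comm]
  rw [show -(1 / L) • d + x - y = (x - y) - (1 / L) • d by module, inner_sub_left,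
    real_inner_smul_left, sub_nonpos, one_div_mul_eq_div, le_div_iff₀ hL,
    inner_sub_right d] at hproj
  rw [hexpand]
  linarith

theorem norm_combination_le {E : Type*} [NormedAddCommGroup E] [NormedSpace ℝ E] {y z : E}
    (hz : ‖z‖ ≤ R) (hy : ‖y‖ ≤ R) (k : ℕ) :
    ‖(2 / ((k : ℝ) + 3)) • z + (((k : ℝ) + 1) / ((k : ℝ) + 3)) • y‖ ≤ R := by
  rw [← mem_closedBall_zero_iff] at *
  exact convex_closedBall 0 R hz hy (by positivity) (by positivity) (by field_simp; ring)

/-- The step `z_k` of the fast gradient method, for the weighted sum `w` of the gradients. -/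
noncomputable def stepZ (R L : ℝ) (w : EuclideanSpace ℝ (Fin M)) :
    EuclideanSpace ℝ (Fin M) :=
  ballProj R (-(1 / L) • w)

/-- The function `L / 2 * ‖v‖ ^ 2 + ∑ i < k, (i + 1) / 2 * (first-order model of f at x_i)`, of
Nesterov's estimate sequence. -/
noncomputable def estimateFun (f : EuclideanSpace ℝ (Fin M) → ℝ)
    (g : EuclideanSpace ℝ (Fin M) → EuclideanSpace ℝ (Fin M)) (R L : ℝ)
    (x₀ : EuclideanSpace ℝ (Fin M)) (k : ℕ) (v : EuclideanSpace ℝ (Fin M)) : ℝ :=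
  L / 2 * ‖v‖ ^ 2 + ∑ i ∈ Finset.range k,
    ((i : ℝ) + 1) / 2 * linearization f g (fastGradient R L g x₀ i).1 v

variable {f : EuclideanSpace ℝ (Fin M) → ℝ}
  {g : EuclideanSpace ℝ (Fin M) → EuclideanSpace ℝ (Fin M)} {x₀ : EuclideanSpace ℝ (Fin M)}

theorem norm_stepY_le (hR : 0 ≤ R) (x : EuclideanSpace ℝ (Fin M)) : ‖stepY R L g x‖ ≤ R :=
  norm_ballProj_le hR _

theorem norm_stepZ_le (hR : 0 ≤ R) (w : EuclideanSpace ℝ (Fin M)) : ‖stepZ R L w‖ ≤ R :=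
  norm_ballProj_le hR _

variable (R L g x₀) in
theorem fastGradient_succ_fst (k : ℕ) : (fastGradient R L g x₀ (k + 1)).1
    = (2 / ((k : ℝ) + 3)) • stepZ R L (fastGradient R L g x₀ (k + 1)).2
      + (((k : ℝ) + 1) / ((k : ℝ) + 3)) • stepY R L g (fastGradient R L g x₀ k).1 := rfl

theorem estimateFun_succ (k : ℕ) (v : EuclideanSpace ℝ (Fin M)) :
    estimateFun f g R L x₀ (k + 1) v = estimateFun f g R L x₀ k v
      + ((k : ℝ) + 1) / 2 * linearization f g (fastGradient R L g x₀ k).1 v := by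
  rw [estimateFun, Finset.sum_range_succ, ← add_assoc, estimateFun]

variable (R L f g x₀) in
theorem estimateFun_sub_estimateFun (k : ℕ) (u v : EuclideanSpace ℝ (Fin M)) :
    estimateFun f g R L x₀ k u - estimateFun f g R L x₀ k v
      = L / 2 * ‖u‖ ^ 2 + inner ℝ (fastGradient R L g x₀ k).2 u
        - (L / 2 * ‖v‖ ^ 2 + inner ℝ (fastGradient R L g x₀ k).2 v) := by
  induction k with
  | zero => simp [estimateFun, fastGradient]
  | succ k ih =>
    simp only [estimateFun_succ, fastGradient, linearization, inner_add_left,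
      real_inner_smul_left, inner_sub_right]
    linear_combination ih

theorem estimateFun_stepZ_add_le (hR : 0 ≤ R) (hL : 0 < L) (k : ℕ)
    {v : EuclideanSpace ℝ (Fin M)} (hv : ‖v‖ ≤ R) :
    estimateFun f g R L x₀ k (stepZ R L (fastGradient R L g x₀ k).2)
      + L / 2 * ‖v - stepZ R L (fastGradient R L g x₀ k).2‖ ^ 2 ≤ estimateFun f g R L x₀ k v := by
  have hmodel := inner_add_sq_ballProj_le hR hL 0 (fastGradient R L g x₀ k).2 hv
  rw [add_zero, ← stepZ, sub_zero, sub_zero] at hmodel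
  linarith [estimateFun_sub_estimateFun R L f g x₀ k v
    (stepZ R L (fastGradient R L g x₀ k).2)]

theorem IsConvexSmooth.apply_stepY_le (h : IsConvexSmooth f g L) (hR : 0 ≤ R) (hL : 0 < L)
    (x : EuclideanSpace ℝ (Fin M)) {v : EuclideanSpace ℝ (Fin M)} (hv : ‖v‖ ≤ R) :
    f (stepY R L g x) ≤ linearization f g x v + L / 2 * ‖v - x‖ ^ 2 := by
  have hupper := h.le_linearization_add x (stepY R L g x)
  have hmodel := inner_add_sq_ballProj_le hR hL x (g x) hv
  have hgrowth : 0 ≤ L / 2 * ‖v - stepY R L g x‖ ^ 2 := by positivity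
  rw [← stepY] at hmodel
  rw [linearization, inner_sub_right] at hupper ⊢
  linarith

/-- The last bracket is the price for a starting point that is not the centre of the ball. -/
theorem IsConvexSmooth.estimateFun_one (h : IsConvexSmooth f g L) (hR : 0 ≤ R) (hL : 0 < L)
    (hx₀ : ‖x₀‖ ≤ R) (z : EuclideanSpace ℝ (Fin M)) :
    f (stepY R L g x₀) / 2
      ≤ estimateFun f g R L x₀ 1 z + (inner ℝ (g x₀) x₀ / 2 + ‖g x₀‖ ^ 2 / (8 * L)) := by
  have hdescent := h.apply_stepY_le hR hL x₀ hx₀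
  have hsquare : L / 2 * ‖z‖ ^ 2 + inner ℝ (g x₀) z / 2 + ‖g x₀‖ ^ 2 / (8 * L)
      = ‖(2 * L) • z + g x₀‖ ^ 2 / (8 * L) := by
    rw [norm_add_sq_real, norm_smul, real_inner_smul_left, Real.norm_of_nonneg (by positivity),
      real_inner_comm]
    field_simp
    ring
  have hnonneg : 0 ≤ ‖(2 * L) • z + g x₀‖ ^ 2 / (8 * L) := by positivity
  simp only [linearization, sub_self, inner_zero_right, norm_zero] at hdescent
  simp only [estimateFun, Finset.sum_range_one, fastGradient, linearization, inner_sub_right]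
  norm_num
  linarith

/-- The upper quadratic bound is compared with its value at `x + 2 / (k + 3) • (z' - z)`, which lies
between `y` and `z'`. -/
theorem IsConvexSmooth.apply_stepY_step_le (h : IsConvexSmooth f g L) (hR : 0 ≤ R) (hL : 0 < L)
    {x y z z' : EuclideanSpace ℝ (Fin M)} {k : ℕ}
    (hx : x = (2 / ((k : ℝ) + 3)) • z + (((k : ℝ) + 1) / ((k : ℝ) + 3)) • y)
    (hy : ‖y‖ ≤ R) (hz' : ‖z'‖ ≤ R) :
    ((k : ℝ) + 2) * (k + 3) / 4 * f (stepY R L g x) ≤ ((k : ℝ) + 1) * (k + 2) / 4 * f y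
      + ((k : ℝ) + 2) / 2 * linearization f g x z' + L / 2 * ‖z' - z‖ ^ 2 := by
  set τ : ℝ := 2 / ((k : ℝ) + 3) with hτ
  have hv : ‖x + τ • (z' - z)‖ ≤ R := by
    rw [show x + τ • (z' - z) = τ • z' + (((k : ℝ) + 1) / ((k : ℝ) + 3)) • y by rw [hx]; module]
    exact norm_combination_le hz' hy k
  have hmodel := h.apply_stepY_le hR hL x hv
  rw [linearization, add_sub_cancel_left, norm_smul, mul_pow, Real.norm_eq_abs, sq_abs,
    real_inner_smul_right] at hmodel
  have hlower : 0 ≤ ((k : ℝ) + 1) * (k + 2) / 4 * (f y - linearization f g x y) :=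
    mul_nonneg (by positivity) (sub_nonneg.mpr (h.linearization_le x y))
  have hinner : ((k : ℝ) + 1) * (k + 2) / 4 * inner ℝ (g x) (y - x)
      + ((k : ℝ) + 2) / 2 * inner ℝ (g x) (z' - x)
      = ((k : ℝ) + 2) * (k + 3) / 4 * (τ * inner ℝ (g x) (z' - z)) := by
    have hgx : inner ℝ (g x) x
        = τ * inner ℝ (g x) z + ((k : ℝ) + 1) / ((k : ℝ) + 3) * inner ℝ (g x) y := by
      nth_rewrite 2 [hx]
      rw [inner_add_right, real_inner_smul_right, real_inner_smul_right]
    rw [inner_sub_right, inner_sub_right, inner_sub_right, hgx, hτ]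
    field_simp
    ring
  have hcoeff : ((k : ℝ) + 2) * (k + 3) / 4 * τ ^ 2 ≤ 1 := by
    rw [hτ, show ((k : ℝ) + 2) * (k + 3) / 4 * (2 / ((k : ℝ) + 3)) ^ 2 = (k + 2) / (k + 3) by
      field_simp; ring, div_le_one (by positivity)]
    linarith
  have hquad := mul_le_mul_of_nonneg_right hcoeff (show 0 ≤ L / 2 * ‖z' - z‖ ^ 2 by positivity)
  have hscaled := mul_le_mul_of_nonneg_left hmodel
    (show 0 ≤ ((k : ℝ) + 2) * (k + 3) / 4 by positivity)
  simp only [linearization] at hlower ⊢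
  linarith

theorem IsConvexSmooth.apply_stepY_le_estimateFun (h : IsConvexSmooth f g L) (hR : 0 ≤ R)
    (hL : 0 < L) (hx₀ : ‖x₀‖ ≤ R) (k : ℕ) :
    ((k : ℝ) + 1) * (k + 2) / 4 * f (stepY R L g (fastGradient R L g x₀ k).1)
      ≤ estimateFun f g R L x₀ (k + 1) (stepZ R L (fastGradient R L g x₀ (k + 1)).2)
        + (inner ℝ (g x₀) x₀ / 2 + ‖g x₀‖ ^ 2 / (8 * L)) := by
  induction k with
  | zero =>
    have hbase := h.estimateFun_one hR hL hx₀ (stepZ R L (fastGradient R L g x₀ 1).2)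
    simp only [fastGradient] at hbase ⊢
    norm_num at hbase ⊢
    linarith
  | succ k ih =>
    have hgrowth := estimateFun_stepZ_add_le (f := f) (g := g) (x₀ := x₀) hR hL (k + 1)
      (norm_stepZ_le (L := L) hR (fastGradient R L g x₀ (k + 2)).2)
    have hstep := h.apply_stepY_step_le hR hL (fastGradient_succ_fst R L g x₀ k)
      (norm_stepY_le hR _) (norm_stepZ_le (L := L) hR (fastGradient R L g x₀ (k + 2)).2)
    rw [estimateFun_succ]
    push_cast
    rw [show (k : ℝ) + 1 + 1 = k + 2 by ring, show (k : ℝ) + 1 + 2 = k + 3 by ring]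
    linarith

theorem IsConvexSmooth.fastGradient_le (h : IsConvexSmooth f g L) (hR : 0 ≤ R) (hL : 0 < L)
    (hx₀ : ‖x₀‖ ≤ R) (n : ℕ) {u : EuclideanSpace ℝ (Fin M)} (hu : ‖u‖ ≤ R) :
    ((n : ℝ) + 1) * (n + 2) / 4 * f (stepY R L g (fastGradient R L g x₀ n).1)
      ≤ estimateFun f g R L x₀ (n + 1) u + (inner ℝ (g x₀) x₀ / 2 + ‖g x₀‖ ^ 2 / (8 * L)) := by
  have hgrowth := estimateFun_stepZ_add_le (f := f) (g := g) (x₀ := x₀) hR hL (n + 1) hu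
  have hnonneg : 0 ≤ L / 2 * ‖u - stepZ R L (fastGradient R L g x₀ (n + 1)).2‖ ^ 2 := by
    positivity
  linarith [h.apply_stepY_le_estimateFun hR hL hx₀ n]

end FastGradient

/-- A channel with finitely many outputs that is continuous on the input set `A` and whose
transition probabilities there are bounded away from zero. -/
structure IsPositiveChannel {M : ℕ} (V : Fin M → ℝ → ℝ) (A : Set ℝ) : Prop where
  continuousOn : ∀ i, ContinuousOn (V i) A
  mem_stdSimplex : ∀ x ∈ A, (fun i => V i x) ∈ stdSimplex ℝ (Fin M)
  minProb_pos : 0 < minProb V A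

section PositiveChannel

variable {M : ℕ} {V : Fin M → ℝ → ℝ} {A : Set ℝ} {x : ℝ}

theorem minProb_le (hV : ∀ x ∈ A, (fun i => V i x) ∈ stdSimplex ℝ (Fin M)) (i : Fin M)
    (hx : x ∈ A) : minProb V A ≤ V i x := by
  refine csInf_le ⟨0, ?_⟩ ⟨i, x, hx, rfl⟩
  rintro _ ⟨j, y, hy, rfl⟩
  exact (hV y hy).1 j

theorem le_minProb [Nonempty (Fin M)] (hA : A.Nonempty) {c : ℝ} (hc : ∀ i, ∀ x ∈ A, c ≤ V i x) :
    c ≤ minProb V A := by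
  obtain ⟨x, hx⟩ := hA
  refine le_csInf ⟨_, Classical.arbitrary _, x, hx, rfl⟩ ?_
  rintro _ ⟨i, y, hy, rfl⟩
  exact hc i y hy

theorem IsPositiveChannel.minProb_le (hV : IsPositiveChannel V A) (i : Fin M) (hx : x ∈ A) :
    minProb V A ≤ V i x :=
  ChannelCapacity.minProb_le hV.mem_stdSimplex i hx

theorem IsPositiveChannel.nonempty_output (hV : IsPositiveChannel V A) : Nonempty (Fin M) := by
  by_contra hM
  rw [not_nonempty_iff] at hM
  simpa [minProb] using hV.minProb_pos

theorem IsPositiveChannel.one_le_card_output (hV : IsPositiveChannel V A) : (1 : ℝ) ≤ M := by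
  exact_mod_cast Fin.pos_iff_nonempty.2 hV.nonempty_output

theorem IsPositiveChannel.minProb_le_one (hV : IsPositiveChannel V A) (hA : A.Nonempty) :
    minProb V A ≤ 1 := by
  obtain ⟨x, hx⟩ := hA
  obtain ⟨i⟩ := hV.nonempty_output
  exact (hV.minProb_le i hx).trans (mem_Icc_of_mem_stdSimplex (hV.mem_stdSimplex x hx) i).2

theorem IsPositiveChannel.logb_inv_minProb_nonneg (hV : IsPositiveChannel V A)
    (hA : A.Nonempty) : 0 ≤ Real.logb 2 (minProb V A)⁻¹ :=
  Real.logb_nonneg one_lt_two ((one_le_inv₀ hV.minProb_pos).2 (hV.minProb_le_one hA))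

theorem minProb_of_subsingleton_output {V : Fin 1 → ℝ → ℝ} (hV : IsPositiveChannel V A)
    (hA : A.Nonempty) : minProb V A = 1 := by
  refine (hV.minProb_le_one hA).antisymm (le_minProb hA fun i x hx => ?_)
  have hsum := (hV.mem_stdSimplex x hx).2
  rw [Fin.sum_univ_one] at hsum
  rw [Subsingleton.elim i 0, hsum]

theorem one_le_one_div_log_two : 1 ≤ 1 / Real.log 2 := by
  rw [le_div_iff₀ (Real.log_pos one_lt_two)]
  linarith [Real.log_two_lt_d9]

theorem dualRadius_nonneg (V : Fin M → ℝ → ℝ) (A : Set ℝ) : 0 ≤ dualRadius V A :=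
  mul_nonneg (Nat.cast_nonneg M)
    (le_max_of_le_right (zero_le_one.trans one_le_one_div_log_two))

theorem IsPositiveChannel.sqrt_mul_max_add_le_dualRadius (hV : IsPositiveChannel V A)
    (hA : A.Nonempty) :
    √M * max (Real.logb 2 (minProb V A)⁻¹) (1 / Real.log 2) + Real.logb 2 (minProb V A)⁻¹ / 2
      ≤ dualRadius V A := by
  have hM := hV.one_le_card_output
  have hmax := le_max_left (Real.logb 2 (minProb V A)⁻¹) (1 / Real.log 2)
  have hmax0 := (hV.logb_inv_minProb_nonneg hA).trans hmax
  rw [dualRadius]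
  obtain rfl | hM2 : M = 1 ∨ 2 ≤ M := by
    have : 1 ≤ M := by exact_mod_cast hM
    omega
  · simp [minProb_of_subsingleton_output hV hA]
  · have hM2' : (2 : ℝ) ≤ M := by exact_mod_cast hM2
    have hsqrt : √(M : ℝ) ≤ M - 1 / 2 := by
      rw [Real.sqrt_le_left (by linarith)]
      nlinarith
    nlinarith

end PositiveChannel

section PayoffLipschitz

variable {M : ℕ} {V : Fin M → ℝ → ℝ} {A : Set ℝ} {γ δ : ℝ}

/-- On `[γ, 1]` the derivative of `t log t` lies in `1 / ln 2 + [-log (1 / γ), 0]`; subtracting the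
linear function whose slope is the midpoint halves the Lipschitz constant. -/
theorem abs_mul_logb_sub_le {u v : ℝ} (hγ : 0 < γ) (hu : u ∈ Set.Icc γ 1)
    (hv : v ∈ Set.Icc γ 1) :
    |(u * Real.logb 2 u - v * Real.logb 2 v)
      - (1 / Real.log 2 - Real.logb 2 γ⁻¹ / 2) * (u - v)| ≤ Real.logb 2 γ⁻¹ / 2 * |u - v| := by
  have _hlog2 : 0 < Real.log 2 := Real.log_pos one_lt_two
  set c := 1 / Real.log 2 - Real.logb 2 γ⁻¹ / 2 with hc
  have hderiv : ∀ t ∈ Set.Icc γ 1, HasDerivWithinAt (fun t => t * Real.logb 2 t - c * t)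
      (Real.logb 2 t + Real.logb 2 γ⁻¹ / 2) (Set.Icc γ 1) t := by
    intro t ht
    have ht0 : t ≠ 0 := (hγ.trans_le ht.1).ne'
    have hmul : HasDerivAt (fun t => t * Real.logb 2 t)
        (1 * Real.logb 2 t + t * (t⁻¹ / Real.log 2)) t :=
      (hasDerivAt_id t).mul ((Real.hasDerivAt_log ht0).div_const (Real.log 2))
    refine ((hmul.sub ((hasDerivAt_id t).const_mul c)).hasDerivWithinAt
      (s := Set.Icc γ 1)).congr_deriv ?_
    rw [hc]
    field_simp
    ring
  have hbound : ∀ t ∈ Set.Icc γ 1,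
      ‖Real.logb 2 t + Real.logb 2 γ⁻¹ / 2‖ ≤ Real.logb 2 γ⁻¹ / 2 := by
    intro t ht
    have hlow : Real.logb 2 γ ≤ Real.logb 2 t := Real.logb_le_logb_of_le one_lt_two hγ ht.1
    have hhigh : Real.logb 2 t ≤ 0 := Real.logb_nonpos one_lt_two (hγ.le.trans ht.1) ht.2
    rw [Real.logb_inv, Real.norm_eq_abs, abs_le]
    constructor <;> linarith
  have hmvt := (convex_Icc γ 1).norm_image_sub_le_of_norm_hasDerivWithin_le hderiv hbound hv hu
  rw [Real.norm_eq_abs, Real.norm_eq_abs] at hmvt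
  convert hmvt using 2
  ring

theorem abs_entropy_sub_entropy_le {u v : Fin M → ℝ} (hγ : 0 < γ)
    (hu : u ∈ stdSimplex ℝ (Fin M)) (hv : v ∈ stdSimplex ℝ (Fin M))
    (hγu : ∀ i, γ ≤ u i) (hγv : ∀ i, γ ≤ v i) :
    |entropy u - entropy v| ≤ Real.logb 2 γ⁻¹ / 2 * ∑ i, |u i - v i| := by
  set c := 1 / Real.log 2 - Real.logb 2 γ⁻¹ / 2
  have hcentred : entropy v - entropy u
      = ∑ i, ((u i * Real.logb 2 (u i) - v i * Real.logb 2 (v i)) - c * (u i - v i)) := by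
    simp only [entropy, Finset.sum_sub_distrib, ← Finset.mul_sum, Finset.sum_neg_distrib, hu.2,
      hv.2]
    ring
  rw [abs_sub_comm, hcentred, Finset.mul_sum]
  refine (Finset.abs_sum_le_sum_abs _ _).trans (Finset.sum_le_sum fun i _ => ?_)
  exact abs_mul_logb_sub_le hγ ⟨hγu i, (mem_Icc_of_mem_stdSimplex hu i).2⟩
    ⟨hγv i, (mem_Icc_of_mem_stdSimplex hv i).2⟩

theorem payoff_sub_payoff (l : EuclideanSpace ℝ (Fin M)) (x y : ℝ) :
    payoff V l x - payoff V l y = ∑ i, l i * (V i x - V i y)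
      - (entropy (fun i => V i x) - entropy fun i => V i y) := by
  simp only [mul_sub, Finset.sum_sub_distrib]
  simp only [payoff, mul_comm (l _)]
  ring

theorem abs_sum_mul_le_norm_mul {l : EuclideanSpace ℝ (Fin M)} {e : Fin M → ℝ} (hδ : 0 ≤ δ)
    (he : ∑ i, e i ^ 2 ≤ δ ^ 2) : |∑ i, l i * e i| ≤ ‖l‖ * δ := by
  refine abs_le_of_sq_le_sq ?_ (by positivity)
  calc (∑ i, l i * e i) ^ 2 ≤ (∑ i, l i ^ 2) * ∑ i, e i ^ 2 :=
        Finset.sum_mul_sq_le_sq_mul_sq _ _ _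
    _ ≤ ‖l‖ ^ 2 * δ ^ 2 := by rw [EuclideanSpace.real_norm_sq_eq]; gcongr
    _ = (‖l‖ * δ) ^ 2 := (mul_pow _ _ _).symm

theorem sum_abs_le_of_sum_sq_le {e : Fin M → ℝ} (hδ : 0 ≤ δ) (he : ∑ i, e i ^ 2 ≤ M * δ ^ 2) :
    ∑ i, |e i| ≤ M * δ := by
  refine le_of_sq_le_sq (?_ : _ ≤ (M * δ) ^ 2) (by positivity)
  calc (∑ i, |e i|) ^ 2 ≤ M * ∑ i, e i ^ 2 := by
        simpa using sq_sum_le_card_mul_sum_sq (s := Finset.univ) (f := fun i => |e i|)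
    _ ≤ M * (M * δ ^ 2) := by gcongr
    _ = (M * δ) ^ 2 := by ring

theorem IsPositiveChannel.abs_payoff_sub_le (hV : IsPositiveChannel V A)
    {l : EuclideanSpace ℝ (Fin M)} (hl : l ∈ dualSet V A) {x y : ℝ} (hx : x ∈ A) (hy : y ∈ A)
    (hδ : 0 ≤ δ) (he : ∑ i, (V i x - V i y) ^ 2 ≤ M * δ ^ 2) :
    |payoff V l x - payoff V l y| ≤ M * dualRadius V A * δ := by
  set ℓ := Real.logb 2 (minProb V A)⁻¹
  set m := max ℓ (1 / Real.log 2)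
  have hℓ0 : 0 ≤ ℓ := hV.logb_inv_minProb_nonneg ⟨x, hx⟩
  have hlinear : |∑ i, l i * (V i x - V i y)| ≤ M * m * (√M * δ) := by
    refine (abs_sum_mul_le_norm_mul (by positivity) ?_).trans
      (mul_le_mul_of_nonneg_right hl (by positivity))
    rwa [mul_pow, Real.sq_sqrt (by positivity)]
  have hentropy : |entropy (fun i => V i x) - entropy fun i => V i y| ≤ ℓ / 2 * (M * δ) := by
    refine (abs_entropy_sub_entropy_le hV.minProb_pos (hV.mem_stdSimplex x hx)
      (hV.mem_stdSimplex y hy) (fun i => hV.minProb_le i hx) fun i => hV.minProb_le i hy).trans ?_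
    gcongr
    exact sum_abs_le_of_sum_sq_le hδ he
  calc |payoff V l x - payoff V l y|
      ≤ M * m * (√M * δ) + ℓ / 2 * (M * δ) := by
        rw [payoff_sub_payoff]
        exact (abs_sub _ _).trans (add_le_add hlinear hentropy)
    _ = M * (√M * m + ℓ / 2) * δ := by ring
    _ ≤ M * dualRadius V A * δ := by
        gcongr
        exact hV.sqrt_mul_max_add_le_dualRadius ⟨x, hx⟩

theorem mul_dualRadius_mul_le_constLf (V : Fin M → ℝ → ℝ) (A : Set ℝ) (L : ℝ≥0) :
    M * dualRadius V A * L ≤ constLf V A L := by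
  have hextra : 0 ≤ M * (L : ℝ) * |Real.logb 2 (minProb V A)⁻¹ - 1 / Real.log 2| := by positivity
  rw [constLf, dualRadius]
  linarith

end PayoffLipschitz

section Truncation

variable {M : ℕ} {X A : Set ℝ} {W : ℕ → ℝ → ℝ} {x y : ℝ}

theorem truncate_eq (hW : IsChannel X W) (hx : x ∈ X) (i : Fin M) :
    truncate W M i x = W i x + (1 / (M : ℝ)) * (1 - ∑ j : Fin M, W j x) := by
  have htail := (hW.2 x hx).summable.sum_add_tsum_nat_add M
  rw [(hW.2 x hx).tsum_eq, Finset.sum_range] at htail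
  rw [truncate, ← htail]
  ring

theorem truncate_mem_stdSimplex (hM : 0 < M) (hW : IsChannel X W) (hx : x ∈ X) :
    (fun i => truncate W M i x) ∈ stdSimplex ℝ (Fin M) := by
  refine ⟨fun i => add_nonneg (hW.1 x hx i)
    (mul_nonneg (by positivity) (tsum_nonneg fun j => hW.1 x hx _)), ?_⟩
  simp only [truncate_eq hW hx, Finset.sum_add_distrib, Finset.sum_const, Finset.card_univ,
    Fintype.card_fin, nsmul_eq_mul]
  field_simp
  ring

theorem continuousOn_truncate (hW : IsChannel X W) (hWc : ∀ i, ContinuousOn (W i) X) (i : Fin M) :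
    ContinuousOn (truncate W M i) X := by
  refine ContinuousOn.congr (f := fun x => W i x + (1 / (M : ℝ)) * (1 - ∑ j : Fin M, W j x)) ?_
    fun x hx => truncate_eq hW hx i
  fun_prop

theorem isPositiveChannel_truncate (hW : IsChannel X W) (hWc : ∀ i, ContinuousOn (W i) X)
    (hAX : A ⊆ X) (hγ : 0 < minProb (truncate W M) A) :
    IsPositiveChannel (truncate W M) A where
  continuousOn i := (continuousOn_truncate hW hWc i).mono hAX
  mem_stdSimplex x hx := by
    refine truncate_mem_stdSimplex (Nat.pos_of_ne_zero ?_) hW (hAX hx)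
    rintro rfl
    simp [minProb] at hγ
  minProb_pos := hγ

theorem sum_sub_mean_sq_le {ι : Type*} [Fintype ι] (d : ι → ℝ) :
    ∑ i, (d i - (1 / (Fintype.card ι : ℝ)) * ∑ j, d j) ^ 2 ≤ ∑ i, d i ^ 2 := by
  cases isEmpty_or_nonempty ι
  · simp
  have hcard : (Fintype.card ι : ℝ) ≠ 0 := by positivity
  have hvariance : ∑ i, (d i - (1 / (Fintype.card ι : ℝ)) * ∑ j, d j) ^ 2
      = ∑ i, d i ^ 2 - (1 / (Fintype.card ι : ℝ)) * (∑ j, d j) ^ 2 := by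
    simp only [sub_sq, Finset.sum_add_distrib, Finset.sum_sub_distrib, ← Finset.mul_sum,
      ← Finset.sum_mul, Finset.sum_const, Finset.card_univ, nsmul_eq_mul]
    field_simp
    ring
  rw [hvariance]
  exact sub_le_self _ (by positivity)

theorem sum_sq_truncate_sub_le (hW : IsChannel X W) {L : ℝ≥0}
    (hL : ∀ i, LipschitzOnWith L (W i) X) (hx : x ∈ X) (hy : y ∈ X) :
    ∑ i, (truncate W M i x - truncate W M i y) ^ 2 ≤ M * (L * |x - y|) ^ 2 := by
  have hcentred : ∀ i, truncate W M i x - truncate W M i y = (W i x - W i y)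
      - (1 / (Fintype.card (Fin M) : ℝ)) * ∑ j : Fin M, (W j x - W j y) := fun i => by
    rw [truncate_eq hW hx, truncate_eq hW hy, Finset.sum_sub_distrib, Fintype.card_fin]
    ring
  simp only [hcentred]
  refine (sum_sub_mean_sq_le fun i : Fin M => W i x - W i y).trans ?_
  calc ∑ i : Fin M, (W i x - W i y) ^ 2 ≤ ∑ _i : Fin M, (L * |x - y|) ^ 2 :=
        Finset.sum_le_sum fun i _ => sq_le_sq.2 <| by
          simpa [abs_mul, Real.dist_eq] using (hL i).dist_le_mul x hx y hy
    _ = M * (L * |x - y|) ^ 2 := by simp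

theorem abs_payoff_truncate_sub_le (hW : IsChannel X W) {L : ℝ≥0}
    (hL : ∀ i, LipschitzOnWith L (W i) X) (hAX : A ⊆ X) (hγ : 0 < minProb (truncate W M) A)
    {l : EuclideanSpace ℝ (Fin M)} (hl : l ∈ dualSet (truncate W M) A) (hx : x ∈ A)
    (hy : y ∈ A) :
    |payoff (truncate W M) l x - payoff (truncate W M) l y|
      ≤ constLf (truncate W M) A L * |x - y| := by
  have hV := isPositiveChannel_truncate hW (fun i => (hL i).continuousOn) hAX hγ
  calc _ ≤ M * dualRadius (truncate W M) A * (L * |x - y|) :=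
        hV.abs_payoff_sub_le hl hx hy (by positivity)
          (sum_sq_truncate_sub_le hW hL (hAX hx) (hAX hy))
    _ = M * dualRadius (truncate W M) A * L * |x - y| := (mul_assoc _ _ _).symm
    _ ≤ constLf (truncate W M) A L * |x - y| := by
        gcongr
        exact mul_dualRadius_mul_le_constLf _ A L

end Truncation

section Tilting

theorem neg_mul_exp_le_half {t d y : ℝ} (ht : 0 < t) (htd : 1 ≤ t * d) :
    -y * Real.exp (t * y) ≤ d / 2 := by
  have hmax : t * (-y * Real.exp (t * y)) ≤ 1 / 2 := by
    have := (Real.mul_exp_neg_le_exp_neg_one (-(t * y))).trans Real.exp_neg_one_lt_half.le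
    rw [neg_neg] at this
    linarith
  have hscaled : t * (-y * Real.exp (t * y)) ≤ t * (d / 2) := by linarith
  exact le_of_mul_le_mul_left hscaled ht

/-- The tilted integrand is at least `exp (t d / 2) d / 2` on `J`, and nowhere is its negative part
of more than constant size, as `z exp (-z)` is bounded. -/
theorem tilt_half_le_add_log {Ω : Type*} [MeasurableSpace Ω] {m : Measure Ω} [IsFiniteMeasure m]
    {h σ : Ω → ℝ} {J : Set Ω} {c φ d t : ℝ} (hJ : MeasurableSet J) (hJ0 : 0 < m.real J)
    (hh : ∀ᵐ x ∂m, h x ∈ Set.Icc c (c + φ)) (hJσ : ∀ᵐ x ∂m, x ∈ J → d / 2 ≤ σ x)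
    (hd : 0 < d) (ht : 0 < t) (htd : 1 ≤ t * d)
    (hi : Integrable (fun x => Real.exp (h x + t * σ x) * σ x) m)
    (hint : ∫ x, Real.exp (h x + t * σ x) * σ x ∂m ≤ 0) :
    t * (d / 2) ≤ φ + Real.log (m.real Set.univ / m.real J) := by
  set gain := Real.exp (c + t * (d / 2)) * (d / 2) with hgain
  set loss := Real.exp (c + φ) * (d / 2) with hloss
  have hpoint : ∀ᵐ x ∂m, J.indicator (fun _ => gain) x - loss
      ≤ Real.exp (h x + t * σ x) * σ x := by
    filter_upwards [hh, hJσ] with x hx hσ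
    by_cases hxJ : x ∈ J
    · have := hσ hxJ
      rw [Set.indicator_of_mem hxJ]
      refine (sub_le_self _ (by positivity)).trans ?_
      rw [hgain]
      gcongr
      exact hx.1
    · have hneg : Real.exp (h x) * (-σ x * Real.exp (t * σ x)) ≤ loss :=
        mul_le_mul_of_nonneg_left (neg_mul_exp_le_half ht htd) (Real.exp_pos _).le |>.trans <| by
          rw [hloss]
          gcongr
          exact hx.2
      rw [Set.indicator_of_notMem hxJ, Real.exp_add]
      linarith
  have hgi : Integrable (J.indicator fun _ => gain) m := (integrable_const gain).indicator hJ
  have hmono := (integral_mono_ae (hgi.sub (integrable_const loss)) hi hpoint).trans hint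
  simp only [Pi.sub_apply] at hmono
  rw [integral_sub hgi (integrable_const loss), integral_indicator_const _ hJ, integral_const,
    smul_eq_mul, smul_eq_mul, sub_nonpos, hgain, hloss, Real.exp_add, Real.exp_add] at hmono
  have hexp : Real.exp (t * (d / 2)) * m.real J ≤ Real.exp φ * m.real Set.univ := by
    refine le_of_mul_le_mul_left (a := Real.exp c * (d / 2)) ?_ (by positivity)
    linarith
  have huniv : 0 < m.real Set.univ := hJ0.trans_le (measureReal_mono (Set.subset_univ J))
  rw [← le_div_iff₀ hJ0, mul_div_assoc] at hexp
  rw [← Real.exp_le_exp, Real.exp_add, Real.exp_log (by positivity)]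
  exact hexp

variable {a b : ℝ} {h σ : ℝ → ℝ} {K : ℝ≥0}

theorem exists_Icc_subset_inter_closedBall {x η : ℝ} (hx : x ∈ Set.Icc a b) (hη : 0 ≤ η)
    (hηab : η ≤ b - a) : ∃ c, Set.Icc c (c + η) ⊆ Set.Icc a b ∩ Metric.closedBall x η := by
  refine ⟨min x (b - η), fun y hy => ?_⟩
  rw [Set.mem_inter_iff, Real.closedBall_eq_Icc]
  obtain ⟨hy₁, hy₂⟩ := hy
  rcases min_cases x (b - η) with ⟨hmin, hle⟩ | ⟨hmin, hle⟩ <;> rw [hmin] at hy₁ hy₂ <;>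
    exact ⟨⟨by linarith [hx.1], by linarith⟩, by linarith [hx.2], by linarith⟩

theorem integrableOn_tilt {A : Set ℝ} (hA : IsCompact A) (hh : ContinuousOn h A)
    (hσ : ContinuousOn σ A) (t : ℝ) :
    IntegrableOn (fun x => Real.exp (h x + t * σ x) * σ x) A :=
  ContinuousOn.integrableOn_compact hA (by fun_prop)

theorem exists_Icc_half_le_of_lipschitzOnWith (hσ : LipschitzOnWith K σ (Set.Icc a b))
    {x₁ : ℝ} (hx₁ : x₁ ∈ Set.Icc a b) (hK : 0 < K) (hσ₁ : 0 ≤ σ x₁)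
    (hlen : σ x₁ / (2 * K) ≤ b - a) :
    ∃ c, Set.Icc c (c + σ x₁ / (2 * K)) ⊆ Set.Icc a b ∧
      ∀ x ∈ Set.Icc c (c + σ x₁ / (2 * K)), σ x₁ / 2 ≤ σ x := by
  obtain ⟨c, hc⟩ := exists_Icc_subset_inter_closedBall hx₁ (by positivity) hlen
  refine ⟨c, fun x hx => (hc hx).1, fun x hx => ?_⟩
  have hlip := (neg_abs_le (σ x - σ x₁)).trans' (neg_le_neg (hσ.dist_le_mul x (hc hx).1 x₁ hx₁))
  have hnear : K * dist x x₁ ≤ K * (σ x₁ / (2 * K)) :=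
    mul_le_mul_of_nonneg_left (hc hx).2 K.2
  have hhalf : K * (σ x₁ / (2 * K)) = σ x₁ / 2 := by field_simp
  linarith

/-- The slack is `≥ log 2` because `σ` changes sign. -/
theorem tilt_half_le_of_lipschitzOnWith (hh : ContinuousOn h (Set.Icc a b))
    (hσ : LipschitzOnWith K σ (Set.Icc a b)) {φ t : ℝ}
    (hφ : ∀ x ∈ Set.Icc a b, ∀ y ∈ Set.Icc a b, h x - h y ≤ φ)
    {x₀ x₁ : ℝ} (hx₀ : x₀ ∈ Set.Icc a b) (hx₁ : x₁ ∈ Set.Icc a b) (hσ₀ : σ x₀ < 0)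
    (hσ₁ : 0 < σ x₁)
    (hint : ∫ x in Set.Icc a b, Real.exp (h x + t * σ x) * σ x ≤ 0) :
    t * (σ x₁ / 2) ≤ φ + Real.log (2 * K * (b - a) / σ x₁) := by
  set d := σ x₁
  have hφ0 : 0 ≤ φ := by simpa using hφ x₁ hx₁ x₁ hx₁
  have hdK : d ≤ K * (b - a) := by
    have hvar := (le_abs_self _).trans (hσ.dist_le_mul x₁ hx₁ x₀ hx₀)
    have := mul_le_mul_of_nonneg_left (Real.dist_le_of_mem_Icc hx₁ hx₀) K.2
    simp only [NNReal.val_eq_coe] at this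
    linarith
  have hK0 : 0 < (K : ℝ) * (b - a) := hσ₁.trans_le hdK
  have hK : 0 < (K : ℝ) := pos_of_mul_pos_left hK0 (by linarith [hx₁.1, hx₁.2])
  have hslack : Real.log 2 ≤ Real.log (2 * K * (b - a) / d) :=
    Real.log_le_log two_pos (by rw [le_div_iff₀ hσ₁]; linarith)
  rcases lt_or_ge (t * d) 1 with hsmall | hlarge
  · linarith [Real.log_two_gt_d9]
  obtain ⟨c, hc, hcσ⟩ := exists_Icc_half_le_of_lipschitzOnWith hσ hx₁ hK hσ₁.le <| by
    rw [div_le_iff₀ (by positivity)]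
    linarith
  set η := d / (2 * K) with hη
  have hη0 : 0 < η := by positivity
  obtain ⟨y, hy, hmin⟩ := isCompact_Icc.exists_isMinOn ⟨x₁, hx₁⟩ hh
  have hvol : (volume.restrict (Set.Icc a b)).real (Set.Icc c (c + η)) = η := by
    rw [measureReal_restrict_apply measurableSet_Icc,
      Set.inter_eq_left.2 hc, Real.volume_real_Icc_of_le (by linarith)]
    ring
  have hbound := tilt_half_le_add_log (m := volume.restrict (Set.Icc a b)) (c := h y) (φ := φ)
    measurableSet_Icc (by rwa [hvol])
    (ae_restrict_of_forall_mem measurableSet_Icc fun x hx =>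
      ⟨hmin hx, by linarith [hφ x hx y hy]⟩)
    (Filter.Eventually.of_forall hcσ) hσ₁ (pos_of_mul_pos_left (by linarith) hσ₁.le) hlarge
    (integrableOn_tilt isCompact_Icc hh hσ.continuousOn t) hint
  rw [hvol, measureReal_restrict_apply_univ,
    Real.volume_real_Icc_of_le (hx₁.1.trans hx₁.2), hη] at hbound
  convert hbound using 3
  field_simp

theorem continuous_integral_tilt {A : Set ℝ} (hA : IsCompact A) (hh : ContinuousOn h A)
    (hσ : ContinuousOn σ A) :
    Continuous fun t : ℝ => ∫ x in A, Real.exp (h x + t * σ x) * σ x := by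
  obtain ⟨Ch, hCh⟩ := hA.exists_bound_of_continuousOn hh
  obtain ⟨Cσ, hCσ⟩ := hA.exists_bound_of_continuousOn hσ
  simp only [Real.norm_eq_abs] at hCh hCσ
  refine continuous_iff_continuousAt.mpr fun t₀ => ?_
  refine continuousAt_of_dominated (bound := fun _ => Real.exp (Ch + (|t₀| + 1) * Cσ) * Cσ)
    (Filter.Eventually.of_forall fun t =>
      (integrableOn_tilt hA hh hσ t).aestronglyMeasurable) ?_
    (integrableOn_const hA.measure_ne_top) (Filter.Eventually.of_forall fun x => by fun_prop)
  filter_upwards [Metric.ball_mem_nhds t₀ one_pos] with t ht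
  refine ae_restrict_of_forall_mem hA.measurableSet fun x hx => ?_
  have htbound : |t| ≤ |t₀| + 1 := by
    have : |t - t₀| < 1 := ht
    linarith [abs_sub_abs_le_abs_sub t t₀]
  have _hCσ0 : 0 ≤ Cσ := (abs_nonneg _).trans (hCσ x hx)
  have hexponent : h x + t * σ x ≤ Ch + (|t₀| + 1) * Cσ := by
    refine add_le_add ((le_abs_self _).trans (hCh x hx)) ((le_abs_self _).trans ?_)
    rw [abs_mul]
    exact mul_le_mul htbound (hCσ x hx) (abs_nonneg _) (by positivity)
  rw [norm_mul, Real.norm_of_nonneg (Real.exp_pos _).le, Real.norm_eq_abs]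
  gcongr
  exact hCσ x hx

theorem exists_integral_tilt_nonneg (hh : ContinuousOn h (Set.Icc a b))
    (hσ : LipschitzOnWith K σ (Set.Icc a b)) {x₀ x₁ : ℝ} (hx₀ : x₀ ∈ Set.Icc a b)
    (hx₁ : x₁ ∈ Set.Icc a b) (hσ₀ : σ x₀ < 0) (hσ₁ : 0 < σ x₁) :
    ∃ t : ℝ, 0 ≤ ∫ x in Set.Icc a b, Real.exp (h x + t * σ x) * σ x := by
  obtain ⟨C, hC⟩ := isCompact_Icc.exists_bound_of_continuousOn hh
  have hφ : ∀ x ∈ Set.Icc a b, ∀ y ∈ Set.Icc a b, h x - h y ≤ 2 * C := fun x hx y hy => by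
    linarith [(abs_le.mp (hC x hx)).2, (abs_le.mp (hC y hy)).1]
  set B := |2 * C + Real.log (2 * K * (b - a) / σ x₁)|
  refine ⟨2 / σ x₁ * (B + 1), not_lt.1 fun hneg => ?_⟩
  have hbound := tilt_half_le_of_lipschitzOnWith hh hσ hφ hx₀ hx₁ hσ₀ hσ₁ hneg.le
  rw [show 2 / σ x₁ * (B + 1) * (σ x₁ / 2) = B + 1 by field_simp] at hbound
  linarith [le_abs_self (2 * C + Real.log (2 * K * (b - a) / σ x₁))]

theorem exists_integral_tilt_eq_zero (hh : ContinuousOn h (Set.Icc a b))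
    (hσ : LipschitzOnWith K σ (Set.Icc a b)) {x₀ x₁ : ℝ} (hx₀ : x₀ ∈ Set.Icc a b)
    (hx₁ : x₁ ∈ Set.Icc a b) (hσ₀ : σ x₀ < 0) (hσ₁ : 0 < σ x₁) :
    ∃ t : ℝ, ∫ x in Set.Icc a b, Real.exp (h x + t * σ x) * σ x = 0 := by
  obtain ⟨t₁, ht₁⟩ := exists_integral_tilt_nonneg hh hσ hx₀ hx₁ hσ₀ hσ₁
  obtain ⟨t₀, ht₀⟩ := exists_integral_tilt_nonneg (σ := fun x => -σ x) hh hσ.neg hx₁ hx₀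
    (neg_lt_zero.2 hσ₁) (neg_pos.2 hσ₀)
  have hneg : ∫ x in Set.Icc a b, Real.exp (h x + -t₀ * σ x) * σ x ≤ 0 := by
    simpa only [mul_neg, integral_neg, neg_mul, neg_nonneg] using ht₀
  exact intermediate_value_univ (-t₀) t₁
    (continuous_integral_tilt isCompact_Icc hh hσ.continuousOn) ⟨hneg, ht₁⟩

end Tilting

section Concentration

variable {a b c K r : ℝ} {w : ℝ → ℝ}

theorem mul_integral_exp_neg (K r : ℝ) :
    K * ∫ y in (0 : ℝ)..r, Real.exp (-(K * y)) = 1 - Real.exp (-(K * r)) := by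
  have hderiv : ∀ y ∈ Set.uIcc 0 r, HasDerivAt (fun y => -Real.exp (-(K * y)))
      (K * Real.exp (-(K * y))) y := fun y _ => by
    have hexponent : HasDerivAt (fun y => -(K * y)) (-(K * 1)) y :=
      ((hasDerivAt_id y).const_mul K).neg
    exact hexponent.exp.neg.congr_deriv (by ring)
  rw [← intervalIntegral.integral_const_mul, intervalIntegral.integral_eq_sub_of_hasDerivAt hderiv
    (Continuous.intervalIntegrable (by fun_prop) _ _), mul_zero, neg_zero, Real.exp_zero]
  ring

theorem mul_exp_neg_le_integral_exp_neg (hK : 0 ≤ K) (hr : 0 ≤ r) :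
    r * Real.exp (-(K * r)) ≤ ∫ y in (0 : ℝ)..r, Real.exp (-(K * y)) := by
  calc r * Real.exp (-(K * r)) = ∫ _y in (0 : ℝ)..r, Real.exp (-(K * r)) := by simp
    _ ≤ ∫ y in (0 : ℝ)..r, Real.exp (-(K * y)) :=
      intervalIntegral.integral_mono_on hr (by simp)
        (Continuous.intervalIntegrable (by fun_prop) _ _) fun y hy => by gcongr; exact hy.2

theorem le_mul_integral_exp_neg (hK : 0 ≤ K) (hr : 0 ≤ r) (hrc : r ≤ c) :
    r ≤ (1 + K * c) * ∫ y in (0 : ℝ)..r, Real.exp (-(K * y)) := by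
  have hnonneg : 0 ≤ ∫ y in (0 : ℝ)..r, Real.exp (-(K * y)) :=
    intervalIntegral.integral_nonneg hr fun y _ => (Real.exp_pos _).le
  calc r = r * (1 - Real.exp (-(K * r))) + r * Real.exp (-(K * r)) := by ring
    _ ≤ (1 + K * r) * ∫ y in (0 : ℝ)..r, Real.exp (-(K * y)) := by
        rw [← mul_integral_exp_neg]
        linarith [mul_exp_neg_le_integral_exp_neg hK hr]
    _ ≤ (1 + K * c) * ∫ y in (0 : ℝ)..r, Real.exp (-(K * y)) := by gcongr

theorem integral_exp_neg_mul_abs_sub (K : ℝ) (hc : c ∈ Set.Icc a b) :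
    ∫ x in Set.Icc a b, Real.exp (-(K * |x - c|))
      = (∫ y in (0 : ℝ)..(c - a), Real.exp (-(K * y)))
        + ∫ y in (0 : ℝ)..(b - c), Real.exp (-(K * y)) := by
  rw [integral_Icc_eq_integral_Ioc, ← intervalIntegral.integral_of_le (hc.1.trans hc.2),
    ← intervalIntegral.integral_add_adjacent_intervals (b := c)
      (Continuous.intervalIntegrable (by fun_prop) _ _)
      (Continuous.intervalIntegrable (by fun_prop) _ _)]
  congr 1
  · rw [← sub_self c, ← intervalIntegral.integral_comp_sub_left (fun y => Real.exp (-(K * y))) c]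
    refine intervalIntegral.integral_congr fun x hx => ?_
    rw [Set.uIcc_of_le hc.1] at hx
    rw [abs_of_nonpos (by linarith [hx.2]), neg_sub]
  · rw [← sub_self c, ← intervalIntegral.integral_comp_sub_right (fun y => Real.exp (-(K * y))) c]
    refine intervalIntegral.integral_congr fun x hx => ?_
    rw [Set.uIcc_of_le hc.2] at hx
    rw [abs_of_nonneg (by linarith [hx.1])]

theorem mul_exp_le_integral_exp (hK : 0 ≤ K) (hw : ContinuousOn w (Set.Icc a b))
    (hc : c ∈ Set.Icc a b) (hwK : ∀ x ∈ Set.Icc a b, w c - w x ≤ K * |x - c|) :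
    (b - a) * Real.exp (w c) ≤ (1 + K * (b - a)) * ∫ x in Set.Icc a b, Real.exp (w x) := by
  have hlower : Real.exp (w c) * ∫ x in Set.Icc a b, Real.exp (-(K * |x - c|))
      ≤ ∫ x in Set.Icc a b, Real.exp (w x) := by
    rw [← integral_const_mul]
    refine setIntegral_mono_on (ContinuousOn.integrableOn_Icc (by fun_prop))
      (ContinuousOn.integrableOn_Icc (by fun_prop)) measurableSet_Icc fun x hx => ?_
    rw [← Real.exp_add, Real.exp_le_exp]
    linarith [hwK x hx]
  have hleft := le_mul_integral_exp_neg hK (sub_nonneg.2 hc.1) (sub_le_sub_right hc.2 a)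
  have hright := le_mul_integral_exp_neg hK (sub_nonneg.2 hc.2) (sub_le_sub_left hc.1 b)
  have hab : 0 ≤ b - a := sub_nonneg.2 (hc.1.trans hc.2)
  calc (b - a) * Real.exp (w c)
      ≤ ((1 + K * (b - a)) * ∫ x in Set.Icc a b, Real.exp (-(K * |x - c|))) * Real.exp (w c) := by
        rw [integral_exp_neg_mul_abs_sub K hc, mul_add]
        gcongr
        linarith
    _ = (1 + K * (b - a)) * (Real.exp (w c) * ∫ x in Set.Icc a b, Real.exp (-(K * |x - c|))) := by
        ring
    _ ≤ (1 + K * (b - a)) * ∫ x in Set.Icc a b, Real.exp (w x) := by gcongr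

end Concentration

section DualEntropy

variable {M : ℕ} {q : Fin M → ℝ}

theorem isProbDensity_count (hq : q ∈ stdSimplex ℝ (Fin M)) : IsProbDensity Measure.count q where
  integrable := .of_finite
  nonneg := Filter.Eventually.of_forall hq.1
  integral_eq_one := by rw [integral_count, hq.2]

theorem entropy_eq_neg_integral_count (q : Fin M → ℝ) :
    entropy q = -∫ i, q i * Real.logb 2 (q i) ∂Measure.count := by
  rw [entropy, integral_count, Finset.sum_neg_distrib]

theorem norm_toLp_le_one (hq : q ∈ stdSimplex ℝ (Fin M)) :
    ‖(WithLp.toLp 2 q : EuclideanSpace ℝ (Fin M))‖ ≤ 1 := by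
  refine le_of_sq_le_sq ?_ zero_le_one
  rw [EuclideanSpace.real_norm_sq_eq, one_pow, ← hq.2]
  exact Finset.sum_le_sum fun i _ =>
    pow_le_of_le_one (hq.1 i) (mem_Icc_of_mem_stdSimplex hq i).2 two_ne_zero

/-- The maximizer of `H(q) - ⟨l, q⟩` over the simplex, which is also the minimizer of the relative
entropy to the weights `2 ^ (-l i)`. -/
noncomputable def softmin (l : EuclideanSpace ℝ (Fin M)) (i : Fin M) : ℝ :=
  (2 : ℝ) ^ (-l i) / ∑ j, (2 : ℝ) ^ (-l j)

theorem entropy_sub_sum_le_logb_sum (hq : q ∈ stdSimplex ℝ (Fin M))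
    (l : EuclideanSpace ℝ (Fin M)) :
    entropy q - ∑ i, l i * q i ≤ Real.logb 2 (∑ i, (2 : ℝ) ^ (-l i)) := by
  have hgibbs := (isProbDensity_count hq).integral_mul_logb_le (r := fun i => (2 : ℝ) ^ (-l i))
    one_lt_two .of_finite (Filter.Eventually.of_forall fun i => by positivity) .of_finite .of_finite
  simp only [Real.logb_rpow two_pos (by norm_num : (2 : ℝ) ≠ 1)] at hgibbs
  rw [← neg_neg (∫ i, q i * Real.logb 2 (q i) ∂Measure.count), ← entropy_eq_neg_integral_count,
    integral_count, integral_count] at hgibbs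
  simp only [mul_comm (q _), neg_mul, Finset.sum_neg_distrib] at hgibbs
  linarith

theorem le_dualF (hq : q ∈ stdSimplex ℝ (Fin M)) (l : EuclideanSpace ℝ (Fin M)) :
    entropy q - ∑ i, l i * q i ≤ dualF l := by
  refine le_csSup ⟨Real.logb 2 (∑ i, (2 : ℝ) ^ (-l i)), ?_⟩ ⟨q, hq, rfl⟩
  rintro _ ⟨r, hr, rfl⟩
  exact entropy_sub_sum_le_logb_sum hr l

variable [Nonempty (Fin M)]

theorem sum_two_rpow_pos (l : EuclideanSpace ℝ (Fin M)) : 0 < ∑ i, (2 : ℝ) ^ (-l i) :=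
  Finset.sum_pos (fun i _ => by positivity) Finset.univ_nonempty

theorem softmin_pos (l : EuclideanSpace ℝ (Fin M)) (i : Fin M) : 0 < softmin l i :=
  div_pos (by positivity) (sum_two_rpow_pos l)

theorem softmin_mem_stdSimplex (l : EuclideanSpace ℝ (Fin M)) :
    softmin l ∈ stdSimplex ℝ (Fin M) := by
  refine ⟨fun i => (softmin_pos l i).le, ?_⟩
  simp only [softmin]
  rw [← Finset.sum_div, div_self (sum_two_rpow_pos l).ne']

theorem integral_mul_logb_softmin (hq : q ∈ stdSimplex ℝ (Fin M))
    (l : EuclideanSpace ℝ (Fin M)) :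
    ∫ i, q i * Real.logb 2 (softmin l i) ∂Measure.count
      = -∑ i, l i * q i - Real.logb 2 (∑ i, (2 : ℝ) ^ (-l i)) := by
  have hlog : ∀ i, q i * Real.logb 2 (softmin l i)
      = -(l i * q i) - q i * Real.logb 2 (∑ i, (2 : ℝ) ^ (-l i)) := fun i => by
    rw [softmin, Real.logb_div (by positivity) (sum_two_rpow_pos l).ne',
      Real.logb_rpow two_pos (by norm_num)]
    ring
  simp only [integral_count, hlog]
  rw [Finset.sum_sub_distrib, ← Finset.sum_mul, hq.2, one_mul, Finset.sum_neg_distrib]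

theorem entropy_sub_sum_le (hq : q ∈ stdSimplex ℝ (Fin M)) (x y : EuclideanSpace ℝ (Fin M)) :
    entropy q - ∑ i, y i * q i
      ≤ (entropy (softmin x) - ∑ i, y i * softmin x i) + 1 / 2 * ‖y - x‖ ^ 2 := by
  have hsoft := softmin_mem_stdSimplex x
  have hlin : ∀ r : Fin M → ℝ, ∫ i, r i * (x - y) i ∂Measure.count
      = ∑ i, x i * r i - ∑ i, y i * r i := fun r => by
    rw [integral_count, ← Finset.sum_sub_distrib]
    exact Finset.sum_congr rfl fun i _ => by rw [PiLp.sub_apply]; ring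
  have hent : ∀ r : Fin M → ℝ, ∫ i, r i * Real.logb 2 (r i) ∂Measure.count = -entropy r :=
    fun r => by rw [entropy_eq_neg_integral_count, neg_neg]
  have hstable := (isProbDensity_count hq).integral_mul_le_add (h := fun i => (x - y) i)
    (B := ‖x - y‖) (isProbDensity_count hsoft) (Filter.Eventually.of_forall (softmin_pos x))
    .of_finite .of_finite (measurable_of_finite _).aestronglyMeasurable
    (Filter.Eventually.of_forall fun i => by simpa using PiLp.norm_apply_le (x - y) i)
  have hself := integral_mul_logb_softmin hsoft x
  rw [hent] at hself
  rw [hlin, hlin, hent, integral_mul_logb_softmin hq, norm_sub_rev] at hstable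
  linarith

theorem isConvexSmooth_dualF :
    IsConvexSmooth dualF (fun l : EuclideanSpace ℝ (Fin M) => -WithLp.toLp 2 (softmin l)) 1 := by
  refine isConvexSmooth_sSup (P := (· ∈ stdSimplex ℝ (Fin M)))
    (val := fun (l : EuclideanSpace ℝ (Fin M)) q => entropy q - ∑ i, l i * q i)
    softmin_mem_stdSimplex (fun x y q hq => entropy_sub_sum_le hq x y) fun x y => ?_
  rw [inner_neg_left, inner_sub_right]
  simp only [PiLp.inner_apply, RCLike.inner_apply, conj_trivial]
  ring

theorem dualF_le_logb_sum (l : EuclideanSpace ℝ (Fin M)) :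
    dualF l ≤ Real.logb 2 (∑ i, (2 : ℝ) ^ (-l i)) := by
  refine csSup_le ⟨_, softmin l, softmin_mem_stdSimplex l, rfl⟩ ?_
  rintro _ ⟨q, hq, rfl⟩
  exact entropy_sub_sum_le_logb_sum hq l

end DualEntropy

section Densities

variable {M : ℕ} {V : Fin M → ℝ → ℝ} {A : Set ℝ} {p k s E : ℝ → ℝ} {S C : ℝ}

theorem IsDensity.isProbDensity (hp : IsDensity A p) : IsProbDensity (volume.restrict A) p :=
  ⟨hp.1, hp.2.1, hp.2.2⟩

theorem IsDensity.integrableOn_mul (hp : IsDensity A p) (hA : IsCompact A)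
    (hk : ContinuousOn k A) : IntegrableOn (fun x => p x * k x) A :=
  hp.1.mul_continuousOn hk hA

theorem IsDensity.integral_mul_mono {k₁ k₂ : ℝ → ℝ} (hp : IsDensity A p) (hA : IsCompact A)
    (hk₁ : ContinuousOn k₁ A) (hk₂ : ContinuousOn k₂ A) (hle : ∀ x ∈ A, k₁ x ≤ k₂ x) :
    ∫ x in A, p x * k₁ x ≤ ∫ x in A, p x * k₂ x := by
  refine integral_mono_ae (hp.integrableOn_mul hA hk₁) (hp.integrableOn_mul hA hk₂) ?_
  filter_upwards [hp.2.1, ae_restrict_mem hA.measurableSet] with x hx hxA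
  exact mul_le_mul_of_nonneg_left (hle x hxA) hx

theorem IsDensity.integral_mul_const (hp : IsDensity A p) (C : ℝ) : ∫ x in A, p x * C = C := by
  rw [MeasureTheory.integral_mul_const, hp.2.2, one_mul]

theorem IsDensity.integral_mul_le (hp : IsDensity A p) (hA : IsCompact A)
    (hk : ContinuousOn k A) (hC : ∀ x ∈ A, k x ≤ C) : ∫ x in A, p x * k x ≤ C := by
  simpa only [hp.integral_mul_const] using hp.integral_mul_mono hA hk continuousOn_const hC

theorem IsFeasible.integral_mul_sub (hp : IsFeasible A s S p)
    (hps : IntegrableOn (fun x => p x * s x) A) : ∫ x in A, p x * (s x - S) = 0 := by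
  simp only [mul_sub]
  rw [integral_sub hps (hp.1.1.mul_const S), hp.2, hp.1.integral_mul_const, sub_self]

theorem isFeasible_div_integral (hE : IntegrableOn E A) (hE0 : ∀ x, 0 ≤ E x)
    (hmass : 0 < ∫ x in A, E x) (hEs : IntegrableOn (fun x => E x * s x) A)
    (hcost : ∫ x in A, E x * (s x - S) = 0) :
    IsFeasible A s S (fun x => E x / ∫ y in A, E y) := by
  refine ⟨⟨hE.div_const _, Filter.Eventually.of_forall fun x => div_nonneg (hE0 x) hmass.le, ?_⟩,
    ?_⟩
  · rw [integral_div, div_self hmass.ne']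
  · simp only [mul_sub] at hcost
    rw [integral_sub hEs (hE.mul_const S), MeasureTheory.integral_mul_const] at hcost
    simp only [div_mul_eq_mul_div]
    rw [integral_div, div_eq_iff hmass.ne']
    linarith

theorem IsDensity.integral_mul_sum (hp : IsDensity A p) (hA : IsCompact A)
    (hV : ∀ i, ContinuousOn (V i) A) (c : Fin M → ℝ) :
    ∫ x in A, p x * ∑ i, V i x * c i = ∑ i, c i * outputDist V A p i := by
  simp only [Finset.mul_sum, outputDist, ← integral_const_mul]
  rw [integral_finsetSum _ fun i _ => hp.integrableOn_mul (k := fun x => V i x * c i) hA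
    ((hV i).mul continuousOn_const)]
  exact Finset.sum_congr rfl fun i _ => integral_congr_ae <|
    Filter.Eventually.of_forall fun x => by ring

theorem IsPositiveChannel.minProb_le_outputDist (hV : IsPositiveChannel V A) (hA : IsCompact A)
    (hp : IsDensity A p) (i : Fin M) : minProb V A ≤ outputDist V A p i := by
  have hmono := hp.integral_mul_mono hA continuousOn_const (hV.continuousOn i)
    fun x hx => hV.minProb_le i hx
  rw [hp.integral_mul_const] at hmono
  simpa only [outputDist, mul_comm] using hmono

theorem IsPositiveChannel.outputDist_pos (hV : IsPositiveChannel V A) (hA : IsCompact A)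
    (hp : IsDensity A p) (i : Fin M) : 0 < outputDist V A p i :=
  hV.minProb_pos.trans_le (hV.minProb_le_outputDist hA hp i)

theorem IsPositiveChannel.outputDist_mem_stdSimplex (hV : IsPositiveChannel V A)
    (hA : IsCompact A) (hp : IsDensity A p) : outputDist V A p ∈ stdSimplex ℝ (Fin M) := by
  refine ⟨fun i => (hV.outputDist_pos hA hp i).le, ?_⟩
  have hsum := hp.integral_mul_sum hA hV.continuousOn fun _ => 1
  simp only [mul_one, one_mul] at hsum
  rw [← hsum, ← hp.2.2]
  exact setIntegral_congr_fun hA.measurableSet fun x hx => by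
    simp only [(hV.mem_stdSimplex x hx).2, mul_one]

end Densities

section Duality

variable {M : ℕ} {V : Fin M → ℝ → ℝ} {A : Set ℝ} {p s : ℝ → ℝ} {S : ℝ} {q : Fin M → ℝ}

theorem continuous_entropy : Continuous (entropy : (Fin M → ℝ) → ℝ) := by
  unfold entropy Real.logb
  simp only [← mul_div_assoc]
  have := Real.continuous_mul_log
  fun_prop

theorem continuousOn_payoff (hV : ∀ i, ContinuousOn (V i) A) (l : EuclideanSpace ℝ (Fin M)) :
    ContinuousOn (payoff V l) A := by
  have hentropy : ContinuousOn (fun x => entropy fun i => V i x) A :=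
    continuous_entropy.comp_continuousOn (continuousOn_pi.2 hV)
  unfold payoff
  fun_prop

theorem payoff_eq_payoff_add (V : Fin M → ℝ → ℝ) (l l' : EuclideanSpace ℝ (Fin M)) (x : ℝ) :
    payoff V l x = payoff V l' x + ∑ i, V i x * (l - l') i := by
  simp only [payoff, PiLp.sub_apply, mul_sub, Finset.sum_sub_distrib]
  ring

theorem IsDensity.integral_mul_payoff (hp : IsDensity A p) (hA : IsCompact A)
    (hV : ∀ i, ContinuousOn (V i) A) (l l' : EuclideanSpace ℝ (Fin M)) :
    ∫ x in A, p x * payoff V l x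
      = (∫ x in A, p x * payoff V l' x) + ∑ i, (l - l') i * outputDist V A p i := by
  rw [← hp.integral_mul_sum hA hV, ← integral_add (hp.integrableOn_mul hA
    (continuousOn_payoff hV l')) (hp.integrableOn_mul hA (by fun_prop))]
  simp only [payoff_eq_payoff_add V l l', mul_add]

/-- The ideal code lengths `-log q`. Used as a dual variable, they turn the mean payoff of a
density with output distribution `q` into its mutual information. -/
noncomputable def codeLength (q : Fin M → ℝ) : EuclideanSpace ℝ (Fin M) :=
  WithLp.toLp 2 fun i => -Real.logb 2 (q i)

theorem entropy_eq_sum_codeLength (q : Fin M → ℝ) : entropy q = ∑ i, codeLength q i * q i :=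
  Finset.sum_congr rfl fun i _ => by rw [codeLength]; ring

theorem payoff_codeLength (V : Fin M → ℝ → ℝ) (hq : ∀ i, 0 < q i) (x : ℝ) :
    payoff V (codeLength q) x = relEntropy (fun i => V i x) q := by
  rw [payoff, entropy, relEntropy, ← Finset.sum_sub_distrib]
  refine Finset.sum_congr rfl fun i _ => ?_
  rcases eq_or_ne (V i x) 0 with h0 | h0
  · simp only [h0, zero_mul, neg_zero, sub_zero]
  · rw [Real.logb_div h0 (hq i).ne', codeLength]
    ring

theorem mutualInfo_eq (hq : ∀ i, 0 < outputDist V A p i) :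
    mutualInfo V A p = ∫ x in A, p x * payoff V (codeLength (outputDist V A p)) x := by
  simp only [mutualInfo, payoff_codeLength V hq, mul_comm]

theorem le_dualG (hA : IsCompact A) (hV : ∀ i, ContinuousOn (V i) A) (hp : IsFeasible A s S p)
    (l : EuclideanSpace ℝ (Fin M)) : ∫ x in A, p x * payoff V l x ≤ dualG V A s S l := by
  have hcont := continuousOn_payoff hV l
  obtain ⟨C, hC⟩ := hA.exists_bound_of_continuousOn hcont
  refine le_csSup ⟨C, ?_⟩ ⟨p, hp, rfl⟩
  rintro _ ⟨p', hp', rfl⟩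
  exact hp'.1.integral_mul_le hA hcont fun x hx => (le_abs_self _).trans (hC x hx)

theorem IsPositiveChannel.mutualInfo_le (hV : IsPositiveChannel V A) (hA : IsCompact A)
    (hp : IsFeasible A s S p) (l : EuclideanSpace ℝ (Fin M)) :
    mutualInfo V A p ≤ dualF l + dualG V A s S l := by
  have hF := le_dualF (hV.outputDist_mem_stdSimplex hA hp.1) l
  have hG := le_dualG hA hV.continuousOn hp l
  rw [hp.1.integral_mul_payoff hA hV.continuousOn l (codeLength (outputDist V A p)),
    ← mutualInfo_eq (hV.outputDist_pos hA hp.1)] at hG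
  rw [entropy_eq_sum_codeLength] at hF
  simp only [PiLp.sub_apply, sub_mul, Finset.sum_sub_distrib] at hG
  linarith

end Duality

section GibbsDensities

variable {M : ℕ} {V : Fin M → ℝ → ℝ} {A : Set ℝ} {p s : ℝ → ℝ} {S ν : ℝ}
  {l : EuclideanSpace ℝ (Fin M)} {μ : ℝ × ℝ}

/-- The natural logarithm of a Gibbs density up to an additive constant, with the multiplier `t` of
the cost constraint in natural units. The cost is centred so that the constraint says that its mean
under the density vanishes. -/
noncomputable def gibbsExponent (V : Fin M → ℝ → ℝ) (s : ℝ → ℝ) (S ν : ℝ)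
    (l : EuclideanSpace ℝ (Fin M)) (t x : ℝ) : ℝ :=
  Real.log 2 * (1 / ν * payoff V l x) + t * (s x - S)

theorem continuousOn_gibbsExponent (hV : ∀ i, ContinuousOn (V i) A) (hs : ContinuousOn s A)
    (S ν : ℝ) (l : EuclideanSpace ℝ (Fin M)) (t : ℝ) :
    ContinuousOn (gibbsExponent V s S ν l t) A := by
  have := continuousOn_payoff hV l
  unfold gibbsExponent
  fun_prop

theorem gibbs_pos (V : Fin M → ℝ → ℝ) (s : ℝ → ℝ) (ν : ℝ) (l : EuclideanSpace ℝ (Fin M))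
    (μ : ℝ × ℝ) (x : ℝ) : 0 < gibbs V s ν l μ x :=
  Real.rpow_pos_of_pos two_pos _

theorem logb_gibbs (V : Fin M → ℝ → ℝ) (s : ℝ → ℝ) (ν : ℝ) (l : EuclideanSpace ℝ (Fin M))
    (μ : ℝ × ℝ) (x : ℝ) :
    Real.logb 2 (gibbs V s ν l μ x) = μ.1 + 1 / ν * payoff V l x + μ.2 * s x :=
  Real.logb_rpow two_pos (by norm_num)

theorem gibbs_eq_mul_exp (V : Fin M → ℝ → ℝ) (s : ℝ → ℝ) (S ν : ℝ)
    (l : EuclideanSpace ℝ (Fin M)) (μ : ℝ × ℝ) (x : ℝ) :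
    gibbs V s ν l μ x
      = (2 : ℝ) ^ (μ.1 + μ.2 * S) * Real.exp (gibbsExponent V s S ν l (Real.log 2 * μ.2) x) := by
  rw [gibbs, gibbsExponent, Real.rpow_def_of_pos two_pos, Real.rpow_def_of_pos two_pos,
    ← Real.exp_add]
  ring_nf

theorem exists_gibbs_eq_div (V : Fin M → ℝ → ℝ) (s : ℝ → ℝ) (S ν : ℝ)
    (l : EuclideanSpace ℝ (Fin M)) (t : ℝ) {Z : ℝ} (hZ : 0 < Z) :
    ∃ μ : ℝ × ℝ, gibbs V s ν l μ = fun x => Real.exp (gibbsExponent V s S ν l t x) / Z := by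
  refine ⟨(-Real.logb 2 Z - t / Real.log 2 * S, t / Real.log 2), funext fun x => ?_⟩
  have hlog2 : Real.log 2 ≠ 0 := (Real.log_pos one_lt_two).ne'
  rw [gibbs_eq_mul_exp V s S]
  simp only [sub_add_cancel, mul_div_cancel₀ t hlog2]
  rw [Real.rpow_neg zero_le_two, Real.rpow_logb two_pos (by norm_num) hZ, inv_mul_eq_div]

theorem exists_isFeasible_gibbs {a b : ℝ} {K : ℝ≥0} (hab : a < b)
    (hV : ∀ i, ContinuousOn (V i) (Set.Icc a b)) (hs : LipschitzOnWith K s (Set.Icc a b))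
    (hlow : sInf (s '' Set.Icc a b) < S) (hhigh : S < sSup (s '' Set.Icc a b)) (ν : ℝ)
    (l : EuclideanSpace ℝ (Fin M)) :
    ∃ μ : ℝ × ℝ, IsFeasible (Set.Icc a b) s S (gibbs V s ν l μ) := by
  have hne : (s '' Set.Icc a b).Nonempty := (Set.nonempty_Icc.2 hab.le).image _
  obtain ⟨_, ⟨x₀, hx₀, rfl⟩, hlt₀⟩ := exists_lt_of_csInf_lt hne hlow
  obtain ⟨_, ⟨x₁, hx₁, rfl⟩, hlt₁⟩ := exists_lt_of_lt_csSup hne hhigh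
  have hf := continuousOn_payoff hV l
  have hsc := hs.continuousOn
  obtain ⟨t, ht⟩ := exists_integral_tilt_eq_zero (K := K) (σ := fun x => s x - S)
    (h := fun x => Real.log 2 * (1 / ν * payoff V l x)) (by fun_prop)
    (fun x hx y hy => by simpa using hs hx hy) hx₀ hx₁ (sub_neg.2 hlt₀) (sub_pos.2 hlt₁)
  have hexp : ContinuousOn (fun x => Real.exp (gibbsExponent V s S ν l t x)) (Set.Icc a b) :=
    (continuousOn_gibbsExponent hV hsc S ν l t).rexp
  have hmass : 0 < ∫ x in Set.Icc a b, Real.exp (gibbsExponent V s S ν l t x) :=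
    integral_pos_of_ae_pos (by simpa using hab) hexp.integrableOn_Icc
      (Filter.Eventually.of_forall fun x => Real.exp_pos _)
  obtain ⟨μ, hμ⟩ := exists_gibbs_eq_div V s S ν l t hmass
  refine ⟨μ, ?_⟩
  rw [hμ]
  exact isFeasible_div_integral hexp.integrableOn_Icc (fun x => (Real.exp_pos _).le) hmass
    (hexp.mul hsc).integrableOn_Icc ht

theorem exists_optDensity_eq_gibbs (hex : ∃ μ : ℝ × ℝ, IsFeasible A s S (gibbs V s ν l μ)) :
    ∃ μ : ℝ × ℝ, optDensity V A s S ν l = gibbs V s ν l μ ∧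
      IsFeasible A s S (gibbs V s ν l μ) := by
  refine ⟨hex.choose, ?_, hex.choose_spec⟩
  rw [optDensity, dif_pos hex]

theorem IsDensity.integrableOn_mul_logb_gibbs (hp : IsDensity A p) (hA : IsCompact A)
    (hV : ∀ i, ContinuousOn (V i) A) (hs : ContinuousOn s A) (ν : ℝ)
    (l : EuclideanSpace ℝ (Fin M)) (μ : ℝ × ℝ) :
    IntegrableOn (fun x => p x * Real.logb 2 (gibbs V s ν l μ x)) A := by
  have := continuousOn_payoff hV l
  simp only [logb_gibbs]
  exact hp.integrableOn_mul hA (by fun_prop)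

theorem IsFeasible.integral_mul_logb_gibbs (hp : IsFeasible A s S p) (hA : IsCompact A)
    (hV : ∀ i, ContinuousOn (V i) A) (hs : ContinuousOn s A) (ν : ℝ)
    (l : EuclideanSpace ℝ (Fin M)) (μ : ℝ × ℝ) :
    ∫ x in A, p x * Real.logb 2 (gibbs V s ν l μ x)
      = μ.1 + 1 / ν * (∫ x in A, p x * payoff V l x) + μ.2 * S := by
  have hconst : IntegrableOn (fun x => p x * μ.1) A := hp.1.1.mul_const _
  have hpayoff := (hp.1.integrableOn_mul hA (continuousOn_payoff hV l)).const_mul (1 / ν)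
  have hsum : IntegrableOn (fun x => p x * μ.1 + 1 / ν * (p x * payoff V l x)) A :=
    hconst.add hpayoff
  have hcost := (hp.1.integrableOn_mul hA hs).const_mul μ.2
  simp only [logb_gibbs, mul_add, mul_left_comm (p _)]
  rw [integral_add hsum hcost, integral_add hconst hpayoff, integral_const_mul,
    integral_const_mul, hp.1.integral_mul_const, hp.2]

theorem IsFeasible.diffEntropy_gibbs (hμ : IsFeasible A s S (gibbs V s ν l μ))
    (hA : IsCompact A) (hV : ∀ i, ContinuousOn (V i) A) (hs : ContinuousOn s A) :
    diffEntropy A (gibbs V s ν l μ)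
      = -(μ.1 + 1 / ν * (∫ x in A, gibbs V s ν l μ x * payoff V l x) + μ.2 * S) := by
  rw [diffEntropy, hμ.integral_mul_logb_gibbs hA hV hs]

end GibbsDensities

section SmoothedDual

variable {M : ℕ} {V : Fin M → ℝ → ℝ} {A : Set ℝ} {p s : ℝ → ℝ} {S ν : ℝ}
  {l : EuclideanSpace ℝ (Fin M)} {μ : ℝ × ℝ}

theorem IsDensity.diffEntropy_le (hp : IsDensity A p) (hA : volume A ≠ ⊤)
    (hpp : IntegrableOn (fun x => p x * Real.logb 2 (p x)) A) :
    diffEntropy A p ≤ Real.logb 2 (volume.real A) := by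
  have hgibbs := hp.isProbDensity.integral_mul_logb_le (r := fun _ => 1) one_lt_two
    (integrableOn_const hA) (Filter.Eventually.of_forall fun _ => one_pos) hpp (by simp)
  simp only [Real.logb_one, mul_zero, integral_zero, setIntegral_const, smul_eq_mul,
    mul_one] at hgibbs
  rw [diffEntropy]
  linarith

/-- The objective of the maximization over densities that defines `G_ν(l)`. -/
noncomputable def smoothObjective (V : Fin M → ℝ → ℝ) (A : Set ℝ) (ν : ℝ)
    (l : EuclideanSpace ℝ (Fin M)) (p : ℝ → ℝ) : ℝ :=
  (∫ x in A, p x * payoff V l x) + ν * diffEntropy A p - ν * Real.logb 2 (volume.real A)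

theorem smoothObjective_sub (hp : IsDensity A p) (hA : IsCompact A)
    (hV : ∀ i, ContinuousOn (V i) A) (ν : ℝ) (l l' : EuclideanSpace ℝ (Fin M)) :
    smoothObjective V A ν l' p
      = smoothObjective V A ν l p + inner ℝ (WithLp.toLp 2 (outputDist V A p)) (l' - l) := by
  rw [smoothObjective, smoothObjective, hp.integral_mul_payoff hA hV l' l]
  simp only [PiLp.inner_apply, RCLike.inner_apply, conj_trivial]
  ring

theorem abs_sum_mul_le_norm {q : Fin M → ℝ} (hq : q ∈ stdSimplex ℝ (Fin M))
    (l : EuclideanSpace ℝ (Fin M)) : |∑ i, q i * l i| ≤ ‖l‖ := by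
  have hinner : ∑ i, q i * l i = inner ℝ l (WithLp.toLp 2 q) := by
    simp only [PiLp.inner_apply, RCLike.inner_apply, conj_trivial]
  rw [hinner]
  exact (abs_real_inner_le_norm _ _).trans
    (mul_le_of_le_one_right (norm_nonneg _) (norm_toLp_le_one hq))

theorem IsPositiveChannel.smoothObjective_le (hV : IsPositiveChannel V A) (hA : IsCompact A)
    (hs : ContinuousOn s A) (hν : 0 < ν) (hμ : IsFeasible A s S (gibbs V s ν l μ))
    (hp : IsFeasible A s S p) (hpp : IntegrableOn (fun x => p x * Real.logb 2 (p x)) A)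
    (l' : EuclideanSpace ℝ (Fin M)) :
    smoothObjective V A ν l' p
      ≤ smoothObjective V A ν l' (gibbs V s ν l μ) + 1 / ν / 2 * ‖l' - l‖ ^ 2 := by
  have hVc := hV.continuousOn
  have hbound : ∀ᵐ x ∂volume.restrict A, |1 / ν * ∑ i, V i x * (l' - l) i| ≤ 1 / ν * ‖l' - l‖ := by
    filter_upwards [ae_restrict_mem hA.measurableSet] with x hx
    rw [abs_mul, abs_of_pos (one_div_pos.2 hν)]
    gcongr
    exact abs_sum_mul_le_norm (hV.mem_stdSimplex x hx) _
  have hstable := hp.1.isProbDensity.integral_mul_le_add hμ.1.isProbDensity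
    (Filter.Eventually.of_forall (gibbs_pos V s ν l μ)) hpp
    (hp.1.integrableOn_mul_logb_gibbs hA hVc hs ν l μ)
    (ContinuousOn.aestronglyMeasurable (by fun_prop) hA.measurableSet) hbound
  simp only [mul_left_comm _ (1 / ν)] at hstable
  rw [integral_const_mul, integral_const_mul, hp.1.integral_mul_sum hA hVc,
    hμ.1.integral_mul_sum hA hVc, hp.integral_mul_logb_gibbs hA hVc hs,
    ← neg_neg (∫ x in A, p x * Real.logb 2 (p x)), ← diffEntropy] at hstable
  have hscaled := mul_le_mul_of_nonneg_left hstable hν.le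
  rw [smoothObjective, smoothObjective, hp.1.integral_mul_payoff hA hVc l' l,
    hμ.1.integral_mul_payoff hA hVc l' l, hμ.diffEntropy_gibbs hA hVc hs]
  field_simp at hscaled ⊢
  linarith

theorem smoothG_eq_sSup (V : Fin M → ℝ → ℝ) (A : Set ℝ) (s : ℝ → ℝ) (S ν : ℝ)
    (l : EuclideanSpace ℝ (Fin M)) :
    smoothG V A s S ν l = sSup {t | ∃ p, (IsFeasible A s S p ∧
      IntegrableOn (fun x => p x * Real.logb 2 (p x)) A) ∧ t = smoothObjective V A ν l p} := by
  simp only [smoothG, smoothObjective, and_assoc]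

theorem IsPositiveChannel.smoothG_eq_smoothObjective_gibbs (hV : IsPositiveChannel V A)
    (hA : IsCompact A) (hs : ContinuousOn s A) (hν : 0 < ν)
    (hμ : IsFeasible A s S (gibbs V s ν l μ)) :
    smoothG V A s S ν l = smoothObjective V A ν l (gibbs V s ν l μ) := by
  rw [smoothG_eq_sSup]
  refine IsGreatest.csSup_eq ⟨⟨_, ⟨hμ, ?_⟩, rfl⟩, ?_⟩
  · exact hμ.1.integrableOn_mul_logb_gibbs hA hV.continuousOn hs ν l μ
  · rintro _ ⟨p, hp, rfl⟩
    simpa using hV.smoothObjective_le hA hs hν hμ hp.1 hp.2 l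

theorem IsPositiveChannel.isConvexSmooth_smoothG (hV : IsPositiveChannel V A) (hA : IsCompact A)
    (hs : ContinuousOn s A) (hν : 0 < ν)
    (hex : ∀ l, ∃ μ : ℝ × ℝ, IsFeasible A s S (gibbs V s ν l μ)) :
    IsConvexSmooth (smoothG V A s S ν)
      (fun l => WithLp.toLp 2 (outputDist V A (optDensity V A s S ν l))) (1 / ν) := by
  rw [show smoothG V A s S ν = _ from funext (smoothG_eq_sSup V A s S ν)]
  refine isConvexSmooth_sSup (opt := optDensity V A s S ν) (fun l => ?_) (fun l l' p hp => ?_)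
    fun l l' => ?_
  all_goals
    obtain ⟨μ, hopt, hμ⟩ := exists_optDensity_eq_gibbs (hex l)
    rw [hopt]
  · exact ⟨hμ, hμ.1.integrableOn_mul_logb_gibbs hA hV.continuousOn hs ν l μ⟩
  · exact hV.smoothObjective_le hA hs hν hμ hp.1 hp.2 l'
  · exact smoothObjective_sub hμ.1 hA hV.continuousOn ν l l'

end SmoothedDual

section SmoothingError

variable {M : ℕ} {V : Fin M → ℝ → ℝ} {A : Set ℝ} {s : ℝ → ℝ} {S ν a b C : ℝ}
  {l : EuclideanSpace ℝ (Fin M)} {μ : ℝ × ℝ}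

/-- The functional `p ↦ ∫ p log p_ν^l` is an affine function of `∫ p f_l` on the feasible densities,
so an upper bound for the density `p_ν^l` bounds `∫ p f_l`. -/
theorem IsPositiveChannel.dualG_le_smoothG_add (hV : IsPositiveChannel V A) (hA : IsCompact A)
    (hvol : 0 < volume.real A) (hs : ContinuousOn s A) (hν : 0 < ν)
    (hμ : IsFeasible A s S (gibbs V s ν l μ))
    (hC : ∀ x ∈ A, volume.real A * gibbs V s ν l μ x ≤ C) :
    dualG V A s S l ≤ smoothG V A s S ν l + ν * Real.logb 2 C := by
  have hVc := hV.continuousOn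
  have hpayoff := continuousOn_payoff hVc l
  have hlog : ∀ x ∈ A, Real.logb 2 (gibbs V s ν l μ x)
      ≤ Real.logb 2 C - Real.logb 2 (volume.real A) := fun x hx => by
    have hpos := gibbs_pos V s ν l μ x
    have := Real.logb_le_logb_of_le one_lt_two (by positivity) (hC x hx)
    rw [Real.logb_mul hvol.ne' hpos.ne'] at this
    linarith
  have hlogc : ContinuousOn (fun x => Real.logb 2 (gibbs V s ν l μ x)) A := by
    simp only [logb_gibbs]
    fun_prop
  rw [hV.smoothG_eq_smoothObjective_gibbs hA hs hν hμ, smoothObjective,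
    hμ.diffEntropy_gibbs hA hVc hs]
  refine csSup_le ⟨_, _, hμ, rfl⟩ ?_
  rintro _ ⟨p, hp, rfl⟩
  have hmean := mul_le_mul_of_nonneg_left (hp.1.integral_mul_le hA hlogc hlog) hν.le
  rw [hp.integral_mul_logb_gibbs hA hVc hs] at hmean
  field_simp at hmean ⊢
  linarith

theorem gibbsExponent_sub_le {Lf Ls x y t : ℝ} (hν : 0 < ν)
    (hf : |payoff V l x - payoff V l y| ≤ Lf * |x - y|) (hs : |s x - s y| ≤ Ls * |x - y|) :
    gibbsExponent V s S ν l (Real.log 2 * t) x - gibbsExponent V s S ν l (Real.log 2 * t) y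
      ≤ Real.log 2 * (Lf / ν + Ls * |t|) * |x - y| := by
  have _hlog2 : 0 < Real.log 2 := Real.log_pos one_lt_two
  have hcost : t * (s x - s y) ≤ |t| * (Ls * |x - y|) :=
    (le_abs_self _).trans (by rw [abs_mul]; gcongr)
  calc gibbsExponent V s S ν l (Real.log 2 * t) x - gibbsExponent V s S ν l (Real.log 2 * t) y
      = Real.log 2 * (1 / ν * (payoff V l x - payoff V l y) + t * (s x - s y)) := by
        simp only [gibbsExponent]
        ring
    _ ≤ Real.log 2 * (1 / ν * (Lf * |x - y|) + |t| * (Ls * |x - y|)) := by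
        gcongr
        exact (le_abs_self _).trans hf
    _ = Real.log 2 * (Lf / ν + Ls * |t|) * |x - y| := by ring

theorem IsFeasible.volume_mul_gibbs_le {Lf : ℝ} {Ls : ℝ≥0}
    (hμ : IsFeasible (Set.Icc a b) s S (gibbs V s ν l μ)) (hν : 0 < ν) (hLf : 0 ≤ Lf)
    (hV : ∀ i, ContinuousOn (V i) (Set.Icc a b))
    (hf : ∀ x ∈ Set.Icc a b, ∀ y ∈ Set.Icc a b,
      |payoff V l x - payoff V l y| ≤ Lf * |x - y|)
    (hs : LipschitzOnWith Ls s (Set.Icc a b)) {x : ℝ} (hx : x ∈ Set.Icc a b) :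
    (b - a) * gibbs V s ν l μ x ≤ 1 + Real.log 2 * (Lf / ν + Ls * |μ.2|) * (b - a) := by
  have _hlog2 : 0 < Real.log 2 := Real.log_pos one_lt_two
  have hconc := mul_exp_le_integral_exp (K := Real.log 2 * (Lf / ν + Ls * |μ.2|)) (by positivity)
    (continuousOn_gibbsExponent hV hs.continuousOn S ν l (Real.log 2 * μ.2)) hx fun y hy => by
      rw [abs_sub_comm]
      exact gibbsExponent_sub_le hν (hf x hx y hy) (hs.dist_le_mul x hx y hy)
  have hmass := hμ.1.2.2
  simp only [gibbs_eq_mul_exp V s S] at hmass ⊢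
  rw [integral_const_mul] at hmass
  have hscaled := mul_le_mul_of_nonneg_left hconc
    (Real.rpow_nonneg zero_le_two (μ.1 + μ.2 * S))
  rwa [mul_left_comm, mul_left_comm ((2 : ℝ) ^ _) (1 + _), hmass, mul_one] at hscaled

theorem IsFeasible.integral_exp_gibbsExponent_mul (hμ : IsFeasible A s S (gibbs V s ν l μ))
    (hA : IsCompact A) (hs : ContinuousOn s A) :
    ∫ x in A, Real.exp (gibbsExponent V s S ν l (Real.log 2 * μ.2) x) * (s x - S) = 0 := by
  have hcost := hμ.integral_mul_sub (hμ.1.integrableOn_mul hA hs)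
  simp only [gibbs_eq_mul_exp V s S, mul_assoc] at hcost
  rw [integral_const_mul] at hcost
  exact (mul_eq_zero.1 hcost).resolve_left (by positivity)

theorem multiplier_le_of_integral_exp_mul_nonpos {f σ : ℝ → ℝ} {m t : ℝ} {Ls : ℝ≥0}
    (hf : ContinuousOn f (Set.Icc a b)) (hσ : LipschitzOnWith Ls σ (Set.Icc a b)) (hab : a < b)
    (hfm : ∀ x ∈ Set.Icc a b, ∀ y ∈ Set.Icc a b, f x - f y ≤ m)
    {x₀ x₁ : ℝ} (hx₀ : x₀ ∈ Set.Icc a b) (hx₁ : x₁ ∈ Set.Icc a b) (hσ₀ : σ x₀ < 0)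
    (hσ₁ : 0 < σ x₁)
    (hint : ∫ x in Set.Icc a b, Real.exp (Real.log 2 * f x + Real.log 2 * t * σ x) * σ x ≤ 0) :
    t ≤ 2 / σ x₁ * (m + Real.logb 2 (max (2 * Ls * (b - a) / σ x₁) 1)) := by
  have hlog2 : 0 < Real.log 2 := Real.log_pos one_lt_two
  have htilt := tilt_half_le_of_lipschitzOnWith (h := fun x => Real.log 2 * f x)
    (φ := Real.log 2 * m) (by fun_prop) hσ (fun x hx y hy => by
      rw [← mul_sub]; exact mul_le_mul_of_nonneg_left (hfm x hx y hy) hlog2.le)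
    hx₀ hx₁ hσ₀ hσ₁ hint
  have hratio : Real.log (2 * Ls * (b - a) / σ x₁)
      ≤ Real.log 2 * Real.logb 2 (max (2 * Ls * (b - a) / σ x₁) 1) := by
    rw [Real.logb, mul_div_cancel₀ _ hlog2.ne']
    have h0 : 0 ≤ 2 * Ls * (b - a) / σ x₁ := by
      have := sub_pos.2 hab
      positivity
    rcases h0.eq_or_lt with h0 | h0
    · simp [← h0]
    · exact Real.log_le_log h0 (le_max_left _ _)
  rw [div_mul_eq_mul_div, le_div_iff₀ hσ₁]
  refine le_of_mul_le_mul_left ?_ hlog2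
  linarith

theorem IsFeasible.abs_multiplier_le {Lf : ℝ} {Ls : ℝ≥0}
    (hμ : IsFeasible (Set.Icc a b) s S (gibbs V s ν l μ)) (hab : a < b) (hν : 0 < ν)
    (hLf : 0 ≤ Lf) (hV : ∀ i, ContinuousOn (V i) (Set.Icc a b))
    (hf : ∀ x ∈ Set.Icc a b, ∀ y ∈ Set.Icc a b,
      |payoff V l x - payoff V l y| ≤ Lf * |x - y|)
    (hs : LipschitzOnWith Ls s (Set.Icc a b)) (hlow : sInf (s '' Set.Icc a b) < S)
    (hhigh : S < sSup (s '' Set.Icc a b)) :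
    |μ.2| ≤ 2 * (Lf * (b - a) / ν)
        * max (1 / -sLow (Set.Icc a b) s S) (1 / sHigh (Set.Icc a b) s S)
      + max (2 / -sLow (Set.Icc a b) s S
          * Real.logb 2 (max (2 * Ls * (b - a) / -sLow (Set.Icc a b) s S) 1))
        (2 / sHigh (Set.Icc a b) s S
          * Real.logb 2 (max (2 * Ls * (b - a) / sHigh (Set.Icc a b) s S) 1)) := by
  have hne : (Set.Icc a b).Nonempty := Set.nonempty_Icc.2 hab.le
  have _hba : 0 ≤ b - a := sub_nonneg.2 hab.le
  obtain ⟨x₀, hx₀, hmin⟩ := isCompact_Icc.exists_sInf_image_eq hne hs.continuousOn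
  obtain ⟨x₁, hx₁, hmax⟩ := isCompact_Icc.exists_sSup_image_eq hne hs.continuousOn
  have hsLow : -sLow (Set.Icc a b) s S = -(s x₀ - S) := by rw [sLow, hmin]; ring
  have hsHigh : sHigh (Set.Icc a b) s S = s x₁ - S := by rw [sHigh, hmax]; ring
  rw [hmin] at hlow
  rw [hmax] at hhigh
  have hpayoff := (continuousOn_payoff hV l).const_mul (1 / ν)
  have hosc : ∀ x ∈ Set.Icc a b, ∀ y ∈ Set.Icc a b,
      1 / ν * payoff V l x - 1 / ν * payoff V l y ≤ Lf * (b - a) / ν := fun x hx y hy => by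
    rw [← mul_sub, one_div_mul_eq_div]
    gcongr
    exact (le_abs_self _).trans ((hf x hx y hy).trans (by
      gcongr; exact abs_sub_le_of_le_of_le hx.1 hx.2 hy.1 hy.2))
  have htilt := hμ.integral_exp_gibbsExponent_mul isCompact_Icc hs.continuousOn
  have hupper := multiplier_le_of_integral_exp_mul_nonpos (t := μ.2) (σ := fun x => s x - S)
    hpayoff (fun x hx y hy => by simpa using hs hx hy) hab hosc hx₀ hx₁ (sub_neg.2 hlow)
    (sub_pos.2 hhigh) htilt.le
  have hlower := multiplier_le_of_integral_exp_mul_nonpos (t := -μ.2)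
    (σ := fun x => -(s x - S)) hpayoff (fun x hx y hy => by simpa using hs hx hy) hab hosc hx₁ hx₀
    (neg_lt_zero.2 (sub_pos.2 hhigh)) (neg_pos.2 (sub_neg.2 hlow)) (by
      simp only [mul_neg, neg_mul, neg_neg, integral_neg]
      exact (neg_eq_zero.2 htilt).le)
  rw [hsLow, hsHigh]
  have hm : 0 ≤ 2 * (Lf * (b - a) / ν) := by positivity
  refine abs_le'.2 ⟨hupper.trans ?_, hlower.trans ?_⟩
  · refine Eq.trans_le (by ring) (add_le_add
      (mul_le_mul_of_nonneg_left (le_max_right _ _) hm) (le_max_right _ _))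
  · refine Eq.trans_le (by ring) (add_le_add
      (mul_le_mul_of_nonneg_left (le_max_left _ _) hm) (le_max_left _ _))

theorem IsPositiveChannel.dualG_le_smoothG_add_logb {L : ℝ} {Ls : ℝ≥0}
    (hV : IsPositiveChannel V (Set.Icc a b)) (hab : a < b) (hν : 0 < ν)
    (hL : 0 ≤ constLf V (Set.Icc a b) L)
    (hf : ∀ x ∈ Set.Icc a b, ∀ y ∈ Set.Icc a b,
      |payoff V l x - payoff V l y| ≤ constLf V (Set.Icc a b) L * |x - y|)
    (hs : LipschitzOnWith Ls s (Set.Icc a b)) (hlow : sInf (s '' Set.Icc a b) < S)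
    (hhigh : S < sSup (s '' Set.Icc a b)) :
    dualG V (Set.Icc a b) s S l ≤ smoothG V (Set.Icc a b) s S ν l
      + ν * Real.logb 2 (1 + Real.log 2
        * (constT₁ V (Set.Icc a b) s S L Ls / ν + constT₂ (Set.Icc a b) s S Ls)) := by
  have _hlog2 : 0 < Real.log 2 := Real.log_pos one_lt_two
  have hba : 0 ≤ b - a := sub_nonneg.2 hab.le
  have hvol : volume.real (Set.Icc a b) = b - a := Real.volume_real_Icc_of_le hab.le
  obtain ⟨μ, hμ⟩ := exists_isFeasible_gibbs hab hV.continuousOn hs hlow hhigh ν l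
  refine hV.dualG_le_smoothG_add isCompact_Icc (hvol ▸ sub_pos.2 hab) hs.continuousOn hν hμ
    fun x hx => ?_
  rw [hvol]
  refine (hμ.volume_mul_gibbs_le hν hL hV.continuousOn hf hs hx).trans ?_
  have hmult := mul_le_mul_of_nonneg_left
    (hμ.abs_multiplier_le hab hν hL hV.continuousOn hf hs hlow hhigh)
    (mul_nonneg Ls.coe_nonneg hba)
  rw [mul_assoc (Real.log 2)]
  gcongr
  rw [constT₁, constT₂, hvol, add_div]
  calc _ = constLf V (Set.Icc a b) L * (b - a) / ν + Ls * (b - a) * |μ.2| := by ring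
    _ ≤ _ := by
      rw [add_assoc]
      gcongr
      refine hmult.trans_eq ?_
      ring

end SmoothingError

section Parameters

variable {α ε T : ℝ}

theorem four_lt_div (hε : 0 < ε) (hεα : ε < α / 4) : 4 < α / ε := by
  rw [lt_div_iff₀ hε]
  linarith

theorem two_lt_logb_div (hε : 0 < ε) (hεα : ε < α / 4) : 2 < Real.logb 2 (α / ε) := by
  have hfour := four_lt_div hε hεα
  rw [Real.lt_logb_iff_rpow_lt one_lt_two (by linarith)]
  norm_num
  exact hfour

theorem smoothing_pos (hε : 0 < ε) (hεα : ε < α / 4) : 0 < smoothing α ε :=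
  div_pos (div_pos hε (by linarith)) (two_pos.trans (two_lt_logb_div hε hεα))

theorem one_div_smoothing (α ε : ℝ) : 1 / smoothing α ε = α / ε * Real.logb 2 (α / ε) := by
  rw [smoothing, one_div_div, div_div_eq_mul_div, mul_div_assoc, mul_comm]

theorem eight_le_one_div_smoothing (hε : 0 < ε) (hεα : ε < α / 4) : 8 ≤ 1 / smoothing α ε := by
  rw [one_div_smoothing]
  nlinarith [two_lt_logb_div hε hεα, four_lt_div hε hεα]

theorem one_add_mul_mul_log_le_rpow {t : ℝ} (ht : 1 ≤ t) :
    1 + T * (t * Real.log t) ≤ t ^ (1 + T) := by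
  have ht0 : 0 < t := one_pos.trans_le ht
  calc 1 + T * (t * Real.log t) ≤ t * (Real.log t * T + 1) := by linarith
    _ ≤ t * t ^ T := by
      gcongr
      rw [Real.rpow_def_of_pos ht0]
      exact Real.add_one_le_exp _
    _ = t ^ (1 + T) := by rw [Real.rpow_add ht0, Real.rpow_one]

theorem smoothing_mul_logb_le {T₁ T₂ : ℝ} (hT₁ : 0 ≤ T₁) (hT₂ : 0 ≤ T₂)
    (hα : α = 2 * (T₁ + T₂ + 1)) (hε : 0 < ε) (hεα : ε < α / 4) :
    smoothing α ε * Real.logb 2 (1 + Real.log 2 * (T₁ / smoothing α ε + T₂)) ≤ ε / 2 := by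
  have _hlog2 : 0 < Real.log 2 := Real.log_pos one_lt_two
  have hν := smoothing_pos hε hεα
  have hinv := eight_le_one_div_smoothing hε hεα
  have hratio := four_lt_div hε hεα
  have hlog := two_lt_logb_div hε hεα
  have herror : T₁ / smoothing α ε + T₂ ≤ (T₁ + T₂) * (1 / smoothing α ε) := by
    rw [div_eq_mul_one_div]
    nlinarith
  have hpower : 1 + Real.log 2 * (T₁ / smoothing α ε + T₂) ≤ (α / ε) ^ (1 + (T₁ + T₂)) := by
    refine le_trans ?_ (one_add_mul_mul_log_le_rpow (by linarith))
    calc 1 + Real.log 2 * (T₁ / smoothing α ε + T₂)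
        ≤ 1 + Real.log 2 * ((T₁ + T₂) * (1 / smoothing α ε)) := by gcongr
      _ = 1 + (T₁ + T₂) * (α / ε * Real.log (α / ε)) := by
        rw [one_div_smoothing, Real.logb]
        field_simp
  calc smoothing α ε * Real.logb 2 (1 + Real.log 2 * (T₁ / smoothing α ε + T₂))
      ≤ smoothing α ε * Real.logb 2 ((α / ε) ^ (1 + (T₁ + T₂))) := by
        gcongr
        exact one_lt_two
    _ = smoothing α ε * ((α / 2) * Real.logb 2 (α / ε)) := by
        rw [Real.logb_rpow_eq_mul_logb_of_pos (by linarith), hα]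
        ring
    _ = ε / 2 := by
        have hα0 : α ≠ 0 := by linarith
        have hlog0 : Real.logb 2 (α / ε) ≠ 0 := by linarith
        rw [smoothing]
        field_simp

theorem mul_le_of_iterBound_le {D : ℝ} (hD : 0 ≤ D) (hε : 0 < ε) (hεα : ε < α / 4) {n : ℕ}
    (hn : iterBound D α ε ≤ n) :
    (1 + 1 / smoothing α ε) * D ≤ ((n : ℝ) + 1) * (n + 2) / 4 * (ε / 2) := by
  have hα : 0 < α := by linarith
  have hratio := four_lt_div hε hεα
  have hlog := two_lt_logb_div hε hεα
  have hsq : 8 * D * α * (Real.logb 2 (α / ε) + 1 / 4) / ε ^ 2 ≤ (n : ℝ) ^ 2 := by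
    refine le_of_eq_of_le ?_ (pow_le_pow_left₀ (by unfold iterBound; positivity) hn 2)
    have hsplit : Real.logb 2 ε⁻¹ + Real.logb 2 α = Real.logb 2 (α / ε) := by
      rw [Real.logb_inv, Real.logb_div hα.ne' hε.ne']
      ring
    rw [iterBound, hsplit, mul_pow, mul_pow, Real.sq_sqrt (by positivity),
      Real.sq_sqrt (by linarith)]
    ring
  have hcount : 8 * D * (α / ε * (Real.logb 2 (α / ε) + 1 / 4)) ≤ ε * (n : ℝ) ^ 2 := by
    refine le_of_eq_of_le ?_ (mul_le_mul_of_nonneg_left hsq hε.le)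
    field_simp
  calc (1 + 1 / smoothing α ε) * D
      = D * (1 + α / ε * Real.logb 2 (α / ε)) := by rw [one_div_smoothing]; ring
    _ ≤ D * (α / ε * (Real.logb 2 (α / ε) + 1 / 4)) := by gcongr; linarith
    _ ≤ ε * (n : ℝ) ^ 2 / 8 := by linarith
    _ ≤ ε * (((n : ℝ) + 1) * (n + 2)) / 8 := by gcongr; nlinarith [Nat.cast_nonneg (α := ℝ) n]
    _ = ((n : ℝ) + 1) * (n + 2) / 4 * (ε / 2) := by ring

theorem iterBound_isBigO (D α : ℝ) :
    (fun ε => ((⌈iterBound D α ε⌉₊ : ℕ) : ℝ)) =O[𝓝[>] 0]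
      fun ε => (1 / ε) * √(Real.logb 2 ε⁻¹) := by
  refine IsBigO.of_bound (√(8 * D * α) * √2 + 1) ?_
  have hlim : Filter.Tendsto (fun ε : ℝ => Real.logb 2 ε⁻¹) (𝓝[>] 0) Filter.atTop :=
    (Real.tendsto_logb_atTop one_lt_two).comp tendsto_inv_nhdsGT_zero
  filter_upwards [hlim.eventually_ge_atTop (|Real.logb 2 α| + 1),
    Ioo_mem_nhdsGT (one_pos : (0 : ℝ) < 1)] with ε hlog hε
  have _hε0 : 0 < ε := hε.1
  have hinv : 1 ≤ 1 / ε := one_le_one_div hε.1 hε.2.le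
  have hsqrt : √(Real.logb 2 ε⁻¹ + Real.logb 2 α + 1 / 4) ≤ √2 * √(Real.logb 2 ε⁻¹) := by
    rw [← Real.sqrt_mul zero_le_two]
    refine Real.sqrt_le_sqrt ?_
    linarith [le_abs_self (Real.logb 2 α)]
  have hone : 1 ≤ 1 / ε * √(Real.logb 2 ε⁻¹) :=
    one_le_mul_of_one_le_of_one_le hinv
      (Real.one_le_sqrt.2 (by linarith [abs_nonneg (Real.logb 2 α)]))
  have hbound : iterBound D α ε ≤ √(8 * D * α) * √2 * (1 / ε * √(Real.logb 2 ε⁻¹)) :=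
    calc iterBound D α ε ≤ 1 / ε * √(8 * D * α) * (√2 * √(Real.logb 2 ε⁻¹)) := by
          unfold iterBound
          gcongr
      _ = _ := by ring
  have hceil := (Nat.ceil_lt_add_one (a := iterBound D α ε) (by unfold iterBound; positivity)).le
  rw [Real.norm_of_nonneg (Nat.cast_nonneg _), Real.norm_of_nonneg (by positivity)]
  linarith

end Parameters

section Constants

variable {M : ℕ} {V : Fin M → ℝ → ℝ} {A : Set ℝ} {s : ℝ → ℝ} {S L : ℝ}

theorem constD₁_nonneg (V : Fin M → ℝ → ℝ) (A : Set ℝ) : 0 ≤ constD₁ V A := by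
  unfold constD₁
  positivity

theorem constLf_nonneg (V : Fin M → ℝ → ℝ) (A : Set ℝ) (hL : 0 ≤ L) : 0 ≤ constLf V A L := by
  have _hmax : 0 ≤ max (Real.logb 2 (minProb V A)⁻¹) (1 / Real.log 2) :=
    le_max_of_le_right (zero_le_one.trans one_le_one_div_log_two)
  unfold constLf
  positivity

theorem constT₁_nonneg (V : Fin M → ℝ → ℝ) (A : Set ℝ) (hL : 0 ≤ L) (Ls : ℝ≥0)
    (hhigh : S < sSup (s '' A)) : 0 ≤ constT₁ V A s S L Ls := by
  have _hmax : 0 ≤ max (1 / -sLow A s S) (1 / sHigh A s S) :=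
    le_max_of_le_right (one_div_nonneg.2 (by rw [sHigh]; linarith))
  have _hLf := constLf_nonneg V A hL
  unfold constT₁
  positivity

theorem constT₂_nonneg (Ls : ℝ≥0) (hhigh : S < sSup (s '' A)) : 0 ≤ constT₂ A s S Ls := by
  have hsHigh : 0 ≤ sHigh A s S := by rw [sHigh]; linarith
  exact mul_nonneg (by positivity) (le_max_of_le_right (mul_nonneg (by positivity)
    (Real.logb_nonneg one_lt_two (le_max_right _ _))))

theorem IsPositiveChannel.card_mul_minProb_le_one (hV : IsPositiveChannel V A)
    (hA : A.Nonempty) : M * minProb V A ≤ 1 := by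
  obtain ⟨x, hx⟩ := hA
  calc M * minProb V A = ∑ _i : Fin M, minProb V A := by simp
    _ ≤ ∑ i, V i x := Finset.sum_le_sum fun i _ => hV.minProb_le i hx
    _ = 1 := (hV.mem_stdSimplex x hx).2

theorem IsPositiveChannel.one_le_logb_inv_minProb (hV : IsPositiveChannel V A)
    (hA : A.Nonempty) (hM : 2 ≤ M) : 1 ≤ Real.logb 2 (minProb V A)⁻¹ := by
  have hγ := hV.minProb_pos
  have hcard : (2 : ℝ) * minProb V A ≤ M * minProb V A := by gcongr; exact_mod_cast hM
  rw [Real.le_logb_iff_rpow_le one_lt_two (by positivity), Real.rpow_one, ← one_div,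
    le_div_iff₀ hγ]
  exact hcard.trans (hV.card_mul_minProb_le_one hA)

theorem one_div_log_two_le_two : 1 / Real.log 2 ≤ 2 := by
  rw [div_le_iff₀ (Real.log_pos one_lt_two)]
  linarith [Real.log_two_gt_d9]

theorem IsPositiveChannel.half_mul_add_dualRadius_add_le (hV : IsPositiveChannel V A)
    (hA : A.Nonempty) {C : ℝ} (hC : 9 ≤ C) :
    C / 2 * (M * Real.logb 2 (minProb V A)⁻¹ ^ 2) + (dualRadius V A + 1 / (2 * C))
      ≤ C * constD₁ V A := by
  have hlow := one_le_one_div_log_two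
  have hhigh := one_div_log_two_le_two
  have hCinv : 1 / (2 * C) ≤ 1 := (div_le_one (by linarith)).2 (by linarith)
  unfold dualRadius constD₁
  rcases Nat.lt_or_ge 1 M with hM | hM
  · have hM2 : (2 : ℝ) ≤ M := by exact_mod_cast hM
    have hℓ := hV.one_le_logb_inv_minProb hA hM
    generalize Real.logb 2 (minProb V A)⁻¹ = ℓ at *
    have hsq : (M * ℓ) ^ 2 ≤ (max (M * ℓ) (1 / Real.log 2)) ^ 2 :=
      pow_le_pow_left₀ (by positivity) (le_max_left _ _) 2
    have hradius : (M : ℝ) * max ℓ (1 / Real.log 2) ≤ M * (2 * ℓ) := by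
      gcongr
      exact max_le (by linarith) (by linarith)
    have hMℓ : 2 ≤ M * ℓ := by nlinarith
    have hcross : (M : ℝ) * ℓ ≤ (M * ℓ) ^ 2 - M * ℓ ^ 2 := by
      have : 0 ≤ (M * ℓ) * ((M - 1) * ℓ - 1) := mul_nonneg (by linarith) (by nlinarith)
      linarith
    have hgain : 9 * (M * ℓ) ≤ C * ((M * ℓ) ^ 2 - M * ℓ ^ 2) :=
      mul_le_mul hC hcross (by linarith) (by linarith)
    have := mul_le_mul_of_nonneg_left hsq (show 0 ≤ C by linarith)
    linarith
  · obtain rfl : M = 1 := hM.antisymm (by exact_mod_cast hV.one_le_card_output)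
    rw [minProb_of_subsingleton_output hV hA]
    simp only [inv_one, Real.logb_one, Nat.cast_one, mul_zero,
      max_eq_right (zero_le_one.trans hlow)]
    nlinarith [mul_le_mul hC hlow zero_le_one (by linarith)]

end Constants

section Averaging

variable {M : ℕ} {V : Fin M → ℝ → ℝ} {A : Set ℝ} {s : ℝ → ℝ} {S ν : ℝ}
  {l : EuclideanSpace ℝ (Fin M)}

theorem isFeasible_optDensity (hex : ∃ μ : ℝ × ℝ, IsFeasible A s S (gibbs V s ν l μ)) :
    IsFeasible A s S (optDensity V A s S ν l) := by
  obtain ⟨μ, hopt, hμ⟩ := exists_optDensity_eq_gibbs hex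
  rwa [hopt]

theorem sum_range_two_mul_add_one_div (n : ℕ) :
    ∑ k ∈ Finset.range (n + 1), 2 * ((k : ℝ) + 1) / (((n : ℝ) + 1) * ((n : ℝ) + 2)) = 1 := by
  rw [← Finset.sum_div, div_eq_one_iff_eq (by positivity)]
  induction n with
  | zero => norm_num
  | succ n ih =>
    rw [Finset.sum_range_succ, ih]
    push_cast
    ring

variable (hex : ∀ l, ∃ μ : ℝ × ℝ, IsFeasible A s S (gibbs V s ν l μ))
  (x₀ : EuclideanSpace ℝ (Fin M)) (n : ℕ)
include hex

theorem integral_primalApprox_mul (hA : IsCompact A) {k : ℝ → ℝ} (hk : ContinuousOn k A) :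
    ∫ x in A, primalApprox V A s S ν x₀ n x * k x
      = ∑ j ∈ Finset.range (n + 1), 2 * ((j : ℝ) + 1) / (((n : ℝ) + 1) * ((n : ℝ) + 2)) *
        ∫ x in A, optDensity V A s S ν (iterX V A s S ν x₀ j) x * k x := by
  simp only [primalApprox, Finset.sum_mul, mul_assoc]
  rw [integral_finsetSum _ fun j _ =>
    ((isFeasible_optDensity (hex _)).1.integrableOn_mul hA hk).const_mul _]
  exact Finset.sum_congr rfl fun j _ => integral_const_mul _ _

theorem isFeasible_primalApprox (hA : IsCompact A) (hs : ContinuousOn s A) :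
    IsFeasible A s S (primalApprox V A s S ν x₀ n) := by
  have hopt : ∀ j, IsFeasible A s S (optDensity V A s S ν (iterX V A s S ν x₀ j)) :=
    fun j => isFeasible_optDensity (hex _)
  refine ⟨⟨integrable_finsetSum _ fun j _ => (hopt j).1.1.const_mul _, ?_, ?_⟩, ?_⟩
  · filter_upwards [ae_all_iff.2 fun j => (hopt j).1.2.1] with x hx
    exact Finset.sum_nonneg fun j _ => mul_nonneg (by positivity) (hx j)
  · simpa only [mul_one, (hopt _).1.2.2, sum_range_two_mul_add_one_div] using
      integral_primalApprox_mul hex x₀ n hA (k := fun _ => 1) continuousOn_const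
  · rw [integral_primalApprox_mul hex x₀ n hA hs]
    simp only [(hopt _).2]
    rw [← Finset.sum_mul, sum_range_two_mul_add_one_div, one_mul]

end Averaging

section CodeLength

variable {M : ℕ} {V : Fin M → ℝ → ℝ} {A : Set ℝ} {q : Fin M → ℝ} {γ : ℝ}

theorem norm_codeLength_sq_le (hγ : 0 < γ) (hq : q ∈ stdSimplex ℝ (Fin M))
    (hγq : ∀ i, γ ≤ q i) : ‖codeLength q‖ ^ 2 ≤ M * Real.logb 2 γ⁻¹ ^ 2 := by
  rw [EuclideanSpace.real_norm_sq_eq]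
  calc _ ≤ ∑ _i : Fin M, Real.logb 2 γ⁻¹ ^ 2 := Finset.sum_le_sum fun i _ => by
        have hlow := Real.logb_le_logb_of_le one_lt_two hγ (hγq i)
        have hhigh := Real.logb_nonpos one_lt_two (hq.1 i) (mem_Icc_of_mem_stdSimplex hq i).2
        rw [Real.logb_inv, codeLength]
        exact pow_le_pow_left₀ (neg_nonneg.2 hhigh) (neg_le_neg hlow) 2
    _ = _ := by simp

theorem IsPositiveChannel.card_mul_logb_sq_le_dualRadius_sq (hV : IsPositiveChannel V A)
    (hA : A.Nonempty) : M * Real.logb 2 (minProb V A)⁻¹ ^ 2 ≤ dualRadius V A ^ 2 := by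
  have hM := hV.one_le_card_output
  have hℓ := hV.logb_inv_minProb_nonneg hA
  rw [dualRadius, mul_pow]
  gcongr
  · exact le_self_pow₀ hM two_ne_zero
  · exact le_max_left _ _

theorem dualF_codeLength_nonpos [Nonempty (Fin M)] (hq : q ∈ stdSimplex ℝ (Fin M))
    (hpos : ∀ i, 0 < q i) : dualF (codeLength q) ≤ 0 := by
  have hpow : ∀ i, (2 : ℝ) ^ (-codeLength q i) = q i := fun i => by
    rw [codeLength, neg_neg, Real.rpow_logb two_pos (by norm_num) (hpos i)]
  simpa only [hpow, hq.2, Real.logb_one] using dualF_le_logb_sum (codeLength q)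

end CodeLength

section PrimalDualGap

variable {M : ℕ} {V : Fin M → ℝ → ℝ} {A : Set ℝ} {s : ℝ → ℝ} {S ν : ℝ}

/-- The objective `F + G_ν` of the fast gradient method. -/
noncomputable def smoothedDual (V : Fin M → ℝ → ℝ) (A : Set ℝ) (s : ℝ → ℝ) (S ν : ℝ)
    (l : EuclideanSpace ℝ (Fin M)) : ℝ :=
  dualF l + smoothG V A s S ν l

/-- The gradient field `∇F + ∇G_ν`, in the form in which `iterX` and `dualApprox` use it. -/
noncomputable def smoothedDualGradient (V : Fin M → ℝ → ℝ) (A : Set ℝ) (s : ℝ → ℝ) (S ν : ℝ)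
    (l : EuclideanSpace ℝ (Fin M)) : EuclideanSpace ℝ (Fin M) :=
  ∇ dualF l + ∇ (smoothG V A s S ν) l

variable {q : Fin M → ℝ} {x₀ : EuclideanSpace ℝ (Fin M)}
  (hV : IsPositiveChannel V A) (hA : IsCompact A) (hs : ContinuousOn s A) (hν : 0 < ν)
  (hex : ∀ l, ∃ μ : ℝ × ℝ, IsFeasible A s S (gibbs V s ν l μ))
include hV hA hs hν hex

theorem IsPositiveChannel.isConvexSmooth_smoothedDual :
    IsConvexSmooth (smoothedDual V A s S ν) (smoothedDualGradient V A s S ν) (1 + 1 / ν) := by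
  have := hV.nonempty_output
  exact isConvexSmooth_dualF.isConvexSmooth_gradient.add
    (hV.isConvexSmooth_smoothG hA hs hν hex).isConvexSmooth_gradient

theorem IsPositiveChannel.norm_smoothedDualGradient_le (l : EuclideanSpace ℝ (Fin M)) :
    ‖smoothedDualGradient V A s S ν l‖ ≤ 2 := by
  have := hV.nonempty_output
  have hF := norm_toLp_le_one (softmin_mem_stdSimplex l)
  have hG := norm_toLp_le_one (hV.outputDist_mem_stdSimplex hA (isFeasible_optDensity (hex l)).1)
  rw [smoothedDualGradient, isConvexSmooth_dualF.gradient_eq,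
    (hV.isConvexSmooth_smoothG hA hs hν hex).gradient_eq]
  refine (norm_add_le _ _).trans ?_
  rw [norm_neg]
  linarith

theorem IsPositiveChannel.linearization_smoothG_le (l u : EuclideanSpace ℝ (Fin M)) :
    linearization (smoothG V A s S ν) (∇ (smoothG V A s S ν)) l u
      ≤ ∫ x in A, optDensity V A s S ν l x * payoff V u x := by
  have hVc := hV.continuousOn
  have hgrad := (hV.isConvexSmooth_smoothG hA hs hν hex).gradient_eq l
  obtain ⟨μ, hopt, hμ⟩ := exists_optDensity_eq_gibbs (hex l)
  rw [linearization, hgrad, hopt, hV.smoothG_eq_smoothObjective_gibbs hA hs hν hμ,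
    ← smoothObjective_sub hμ.1 hA hVc, smoothObjective]
  have hentropy := hμ.1.diffEntropy_le hA.measure_ne_top
    (hμ.1.integrableOn_mul_logb_gibbs hA hVc hs ν l μ)
  linarith [mul_le_mul_of_nonneg_left hentropy hν.le]

theorem IsPositiveChannel.linearization_codeLength_le (hq : q ∈ stdSimplex ℝ (Fin M))
    (hpos : ∀ i, 0 < q i) (l : EuclideanSpace ℝ (Fin M)) :
    linearization (smoothedDual V A s S ν) (smoothedDualGradient V A s S ν) l (codeLength q)
      ≤ ∫ x in A, optDensity V A s S ν l x * payoff V (codeLength q) x := by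
  have := hV.nonempty_output
  have hF := isConvexSmooth_dualF.isConvexSmooth_gradient.linearization_le l (codeLength q)
  refine (linearization_add l (codeLength q)).trans_le ?_
  linarith [dualF_codeLength_nonpos hq hpos,
    hV.linearization_smoothG_le hA hs hν hex l (codeLength q)]

variable (x₀) in
theorem IsPositiveChannel.estimateFun_codeLength_le (n : ℕ)
    (hq : q = outputDist V A (primalApprox V A s S ν x₀ n)) :
    estimateFun (smoothedDual V A s S ν) (smoothedDualGradient V A s S ν) (dualRadius V A)
        (1 + 1 / ν) x₀ (n + 1) (codeLength q)
      ≤ (1 + 1 / ν) / 2 * ‖codeLength q‖ ^ 2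
        + ((n : ℝ) + 1) * (n + 2) / 4 * mutualInfo V A (primalApprox V A s S ν x₀ n) := by
  have hp := (isFeasible_primalApprox hex x₀ n hA hs).1
  have hpos : ∀ i, 0 < q i := hq ▸ hV.outputDist_pos hA hp
  have hmem : q ∈ stdSimplex ℝ (Fin M) := hq ▸ hV.outputDist_mem_stdSimplex hA hp
  rw [mutualInfo_eq (hV.outputDist_pos hA hp), ← hq, integral_primalApprox_mul hex x₀ n hA
    (continuousOn_payoff hV.continuousOn _), Finset.mul_sum]
  refine add_le_add le_rfl (Finset.sum_le_sum fun k _ => ?_)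
  refine (mul_le_mul_of_nonneg_left
    (hV.linearization_codeLength_le hA hs hν hex hmem hpos _) (by positivity)).trans_eq ?_
  rw [← mul_assoc]
  congr 1
  field_simp
  norm_num

theorem IsPositiveChannel.start_error_le (hx₀ : x₀ ∈ dualSet V A) :
    inner ℝ (smoothedDualGradient V A s S ν x₀) x₀ / 2
        + ‖smoothedDualGradient V A s S ν x₀‖ ^ 2 / (8 * (1 + 1 / ν))
      ≤ dualRadius V A + 1 / (2 * (1 + 1 / ν)) := by
  have hnorm := hV.norm_smoothedDualGradient_le hA hs hν hex x₀
  have hinner : inner ℝ (smoothedDualGradient V A s S ν x₀) x₀ ≤ 2 * dualRadius V A :=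
    (real_inner_le_norm _ _).trans (mul_le_mul hnorm hx₀ (norm_nonneg _) zero_le_two)
  have hsq : ‖smoothedDualGradient V A s S ν x₀‖ ^ 2 / (8 * (1 + 1 / ν))
      ≤ 2 ^ 2 / (8 * (1 + 1 / ν)) := by gcongr
  refine add_le_add (by linarith) (hsq.trans_eq ?_)
  field_simp
  norm_num

theorem IsPositiveChannel.smoothedDual_dualApprox_sub_le (hA₀ : A.Nonempty) (hν8 : 8 ≤ 1 / ν)
    (n : ℕ) (hx₀ : x₀ ∈ dualSet V A) :
    ((n : ℝ) + 1) * (n + 2) / 4 * (smoothedDual V A s S ν (dualApprox V A s S ν x₀ n)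
      - mutualInfo V A (primalApprox V A s S ν x₀ n)) ≤ (1 + 1 / ν) * constD₁ V A := by
  have hp := (isFeasible_primalApprox hex x₀ n hA hs).1
  have hR := dualRadius_nonneg V A
  obtain ⟨q, hq⟩ : ∃ q, q = outputDist V A (primalApprox V A s S ν x₀ n) := ⟨_, rfl⟩
  have hnorm : ‖codeLength q‖ ^ 2 ≤ M * Real.logb 2 (minProb V A)⁻¹ ^ 2 :=
    norm_codeLength_sq_le hV.minProb_pos (hq ▸ hV.outputDist_mem_stdSimplex hA hp)
      (hq ▸ hV.minProb_le_outputDist hA hp)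
  have hball : ‖codeLength q‖ ≤ dualRadius V A :=
    le_of_sq_le_sq (hnorm.trans (hV.card_mul_logb_sq_le_dualRadius_sq hA₀)) hR
  have hgradient := (hV.isConvexSmooth_smoothedDual hA hs hν hex).fastGradient_le hR
    (by linarith) hx₀ n hball
  have hestimate := hV.estimateFun_codeLength_le x₀ hA hs hν hex n hq
  have hstart := hV.start_error_le hA hs hν hex hx₀
  have hconst := hV.half_mul_add_dualRadius_add_le hA₀ (C := 1 + 1 / ν) (by linarith)
  have hscaled := mul_le_mul_of_nonneg_left hnorm (show 0 ≤ (1 + 1 / ν) / 2 by linarith)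
  change ((n : ℝ) + 1) * (n + 2) / 4 * smoothedDual V A s S ν (dualApprox V A s S ν x₀ n) ≤ _
    at hgradient
  linarith

end PrimalDualGap

section EpsSolution

variable {M : ℕ} {V : Fin M → ℝ → ℝ} {A : Set ℝ} {s : ℝ → ℝ} {S : ℝ}

theorem IsPositiveChannel.isEpsSolution_of_le (hV : IsPositiveChannel V A) (hA : IsCompact A)
    {l : EuclideanSpace ℝ (Fin M)} {p : ℝ → ℝ} {ε : ℝ} (hl : l ∈ dualSet V A)
    (hp : IsFeasible A s S p) (hgap : dualF l + dualG V A s S l ≤ mutualInfo V A p + ε) :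
    IsEpsSolution V A s S ε l p := by
  refine ⟨hl, hp, ?_, ?_, fun l' => ?_, fun p' hp' => ?_⟩
  · linarith [hV.mutualInfo_le hA hp l]
  · linarith
  · linarith [hV.mutualInfo_le hA hp l']
  · linarith [hV.mutualInfo_le hA hp' l]

theorem IsPositiveChannel.isEpsSolution_of_iterBound_le {a b α ε L : ℝ} {Ls : ℝ≥0} {n : ℕ}
    {x₀ : EuclideanSpace ℝ (Fin M)} (hV : IsPositiveChannel V (Set.Icc a b)) (hab : a < b)
    (hL : 0 ≤ L) (hf : ∀ l ∈ dualSet V (Set.Icc a b), ∀ x ∈ Set.Icc a b, ∀ y ∈ Set.Icc a b,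
      |payoff V l x - payoff V l y| ≤ constLf V (Set.Icc a b) L * |x - y|)
    (hs : LipschitzOnWith Ls s (Set.Icc a b)) (hlow : sInf (s '' Set.Icc a b) < S)
    (hhigh : S < sSup (s '' Set.Icc a b)) (hα : α = constα V (Set.Icc a b) s S L Ls)
    (hε : 0 < ε) (hεα : ε < α / 4) (hn : iterBound (constD₁ V (Set.Icc a b)) α ε ≤ n)
    (hx₀ : x₀ ∈ dualSet V (Set.Icc a b)) :
    IsEpsSolution V (Set.Icc a b) s S ε
      (dualApprox V (Set.Icc a b) s S (smoothing α ε) x₀ n)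
      (primalApprox V (Set.Icc a b) s S (smoothing α ε) x₀ n) := by
  have hA : IsCompact (Set.Icc a b) := isCompact_Icc
  have hν := smoothing_pos hε hεα
  have hex := exists_isFeasible_gibbs hab hV.continuousOn hs hlow hhigh (smoothing α ε)
  have hl : dualApprox V (Set.Icc a b) s S (smoothing α ε) x₀ n ∈ dualSet V (Set.Icc a b) :=
    norm_stepY_le (dualRadius_nonneg V _) _
  have hgradient := (hV.smoothedDual_dualApprox_sub_le hA hs.continuousOn hν hex
    (Set.nonempty_Icc.2 hab.le) (eight_le_one_div_smoothing hε hεα) n hx₀).trans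
    (mul_le_of_iterBound_le (constD₁_nonneg V _) hε hεα hn)
  have hsmoothed := le_of_mul_le_mul_left hgradient (by positivity)
  have hsmoothing := hV.dualG_le_smoothG_add_logb hab hν (constLf_nonneg V _ hL) (hf _ hl) hs
    hlow hhigh
  have hν_error := smoothing_mul_logb_le (constT₁_nonneg V _ hL Ls hhigh)
    (constT₂_nonneg Ls hhigh) hα hε hεα
  rw [smoothedDual] at hsmoothed
  exact hV.isEpsSolution_of_le hA hl (isFeasible_primalApprox hex x₀ n hA hs.continuousOn)
    (by linarith)

end EpsSolution

end ChannelCapacity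

theorem mainTheorem11 {X : Set ℝ} {W : ℕ → ℝ → ℝ} (hW : IsChannel X W)
    {L : ℝ≥0} (hL : ∀ i, LipschitzOnWith L (W i) X)
    {a b : ℝ} (hab : a < b) (hAX : Set.Icc a b ⊆ X)
    {M : ℕ} (hγ : 0 < minProb (truncate W M) (Set.Icc a b))
    {s : ℝ → ℝ} {Ls : ℝ≥0} (hs : LipschitzOnWith Ls s X)
    {S : ℝ} (hS₁ : sInf (s '' Set.Icc a b) < S) (hS₂ : S < sSup (s '' Set.Icc a b)) :
    let A : Set ℝ := Set.Icc a b
    let V : Fin M → ℝ → ℝ := truncate W M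
    let α : ℝ := constα V A s S L Ls
    let D₁ : ℝ := constD₁ V A
    -- the analytical optimizers exist
    (∀ ν : ℝ, 0 < ν → ∀ l, ∃ μ : ℝ × ℝ, IsFeasible A s S (gibbs V s ν l μ)) ∧
    -- the a priori bound
    (∀ ε : ℝ, 0 < ε → ε < α / 4 → ∀ n : ℕ, iterBound D₁ α ε ≤ n →
      ∀ x₀ ∈ dualSet V A,
        IsEpsSolution V A s S ε
          (dualApprox V A s S (smoothing α ε) x₀ n)
          (primalApprox V A s S (smoothing α ε) x₀ n)) ∧
    -- the complexity
    ∃ N : ℝ → ℕ,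
      ((fun ε => (N ε : ℝ)) =O[𝓝[>] 0] fun ε => (1 / ε) * √(Real.logb 2 ε⁻¹)) ∧
      ∀ ε : ℝ, 0 < ε → ε < α / 4 → ∀ x₀ ∈ dualSet V A,
        IsEpsSolution V A s S ε
          (dualApprox V A s S (smoothing α ε) x₀ (N ε))
          (primalApprox V A s S (smoothing α ε) x₀ (N ε)) := by
  intro A V α D₁
  have hV : IsPositiveChannel V A :=
    isPositiveChannel_truncate hW (fun i => (hL i).continuousOn) hAX hγ
  have hsA : LipschitzOnWith Ls s A := hs.mono hAX
  have hbound : ∀ ε : ℝ, 0 < ε → ε < α / 4 → ∀ n : ℕ, iterBound D₁ α ε ≤ n →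
      ∀ x₀ ∈ dualSet V A, IsEpsSolution V A s S ε
        (dualApprox V A s S (smoothing α ε) x₀ n)
        (primalApprox V A s S (smoothing α ε) x₀ n) := fun ε hε hεα n hn x₀ hx₀ =>
    hV.isEpsSolution_of_iterBound_le hab L.coe_nonneg
      (fun l hl x hx y hy => abs_payoff_truncate_sub_le hW hL hAX hγ hl hx hy)
      hsA hS₁ hS₂ rfl hε hεα hn hx₀
  exact ⟨fun ν _ l => exists_isFeasible_gibbs hab hV.continuousOn hsA hS₁ hS₂ ν l, hbound,
    fun ε => ⌈iterBound D₁ α ε⌉₊, iterBound_isBigO D₁ α,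
    fun ε hε hεα x₀ hx₀ => hbound ε hε hεα _ (Nat.le_ceil _) x₀ hx₀⟩
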